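/- Let $n\ge 1$, let $\mathbb{B}_n$ be the open unit ball of $\mathbb{C}^n$ with Lebesgue measure $\nu_n$ normalized so that $\nu_n(\mathbb{B}_n)=1$, and write $L^p=L^p(\mathbb{B}_n,\nu_n)$ (complex-valued functions). Let the Bergman space $A^2$ be the closed subspace of $L^2$ of functions that are holomorphic in $\mathbb{B}_n$, and let $P:L^2\to A^2$ be the orthogonal projection. For $u\in L^2$, the Toeplitz operator $T_u$ is given by $T_u\varphi=P(u\varphi)$ for all bounded holomorphic functions $\varphi$ on $\mathbb{B}_n$; if $u\in L^\infty$, then $T_u\varphi=P(u\varphi)$ is defined for all $\varphi\in A^2$. A function $f$ on $\mathbb{B}_n$ is radial if there is a function $\tilde f$ on $[0,1)$ with $f(z)=\tilde f(|z|)$ for all $z\in\mathbb{B}_n$. Let $N,M\ge 0$ and let $f_1,\dots,f_N,g_1,\dots,g_M\in L^\infty$ be radial functions, none of which is zero almost everywhere. Let $f\in L^2$. Consider the product $T=T_{f_1}\cdots T_{f_N}T_fT_{g_1}\cdots T_{g_M}$ on its natural domain, which consists of all $\varphi\in A^2$ for which $T_{g_1}\cdots T_{g_M}\varphi$ is bounded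 on $\mathbb{B}_n$. Then $T$ is densely defined on $A^2$, and if $T\varphi=0$ for all $\varphi$ in its domain, then $f=0$ almost everywhere. In particular, if $h_1,\dots,h_K\in L^\infty$ ($K\ge 1$) are functions all of which except possibly one are radial, and $T_{h_1}\cdots T_{h_K}=0$ on $A^2$, then one of the functions $h_i$ is zero almost everywhere. -/

import Mathlib

open MeasureTheory Metric Filter
open scoped ENNReal Topology

noncomputable section

namespace BergmanBall

/-- Lebesgue measure on the open unit ball of `ℂⁿ`, normalized to total mass one
(as a measure on `ℂⁿ` that does not charge the complement of the ball). -/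
def ballMeasure (n : ℕ) : Measure (EuclideanSpace ℂ (Fin n)) :=
  (volume (ball (0 : EuclideanSpace ℂ (Fin n)) 1))⁻¹ •
    volume.restrict (ball (0 : EuclideanSpace ℂ (Fin n)) 1)

instance ballMeasure_isProbabilityMeasure (n : ℕ) : IsProbabilityMeasure (ballMeasure n) := by
  refine ⟨?_⟩
  simp only [ballMeasure, Measure.smul_apply, Measure.restrict_apply_univ, smul_eq_mul]
  exact ENNReal.inv_mul_cancel (measure_ball_pos volume _ one_pos).ne' measure_ball_lt_top.ne

/-- Mean value property of holomorphic functions over balls. -/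
lemma setIntegral_ball_eq {n : ℕ} {F : EuclideanSpace ℂ (Fin n) → ℂ}
    {U : Set (EuclideanSpace ℂ (Fin n))} {δ : ℝ}
    (hU : closedBall 0 δ ⊆ U) (hF : DifferentiableOn ℂ F U) :
    ∫ w in ball 0 δ, F w = (volume.real (ball (0 : EuclideanSpace ℂ (Fin n)) δ) : ℂ) * F 0 := by
  have hrot : ∀ θ : ℝ, ∫ w in ball (0 : EuclideanSpace ℂ (Fin n)) δ,
      F (Complex.exp (θ * Complex.I) • w) = ∫ w in ball 0 δ, F w := by
    intro θ
    have hne : Complex.exp (θ * Complex.I) ≠ 0 := Complex.exp_ne_zero _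
    let e : EuclideanSpace ℂ (Fin n) ≃ₗᵢ[ℝ] EuclideanSpace ℂ (Fin n) :=
      { (LinearEquiv.smulOfNeZero ℂ (EuclideanSpace ℂ (Fin n)) _ hne).restrictScalars ℝ with
        norm_map' := fun w => by
          change ‖Complex.exp (θ * Complex.I) • w‖ = ‖w‖
          rw [norm_smul, Complex.norm_exp_ofReal_mul_I, one_mul] }
    have he : ∀ w, e w = Complex.exp (θ * Complex.I) • w := fun w => rfl
    have h := e.measurePreserving.setIntegral_preimage_emb
      e.toHomeomorph.measurableEmbedding F (ball 0 δ)
    have hp : e ⁻¹' ball 0 δ = ball 0 δ := by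
      ext w; simp
    rw [hp] at h
    simpa only [he] using h
  have hmean : ∀ w ∈ ball (0 : EuclideanSpace ℂ (Fin n)) δ,
      ∫ θ in (0 : ℝ)..2 * Real.pi, F (Complex.exp (θ * Complex.I) • w) =
        (2 * Real.pi : ℝ) • F 0 := by
    intro w hw
    have hd : DifferentiableOn ℂ (fun t : ℂ => F (t • w)) (closedBall 0 |(1 : ℝ)|) := by
      refine hF.comp (by fun_prop) ?_
      intro t ht
      apply hU
      simp only [abs_one, mem_closedBall, dist_zero_right, mem_ball] at ht hw ⊢
      rw [norm_smul]
      nlinarith [norm_nonneg w, norm_nonneg t]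
    have h := (hd.diffContOnCl_ball subset_rfl).circleAverage
    simp only [Real.circleAverage_def, circleMap, zero_smul, zero_add, Complex.ofReal_one,
      one_mul] at h
    rw [← h, smul_smul, mul_inv_cancel₀ (by positivity), one_smul]
  have hswap : ∫ θ in (0 : ℝ)..2 * Real.pi, ∫ w in ball (0 : EuclideanSpace ℂ (Fin n)) δ,
      F (Complex.exp (θ * Complex.I) • w) = ∫ w in ball (0 : EuclideanSpace ℂ (Fin n)) δ,
      ∫ θ in (0 : ℝ)..2 * Real.pi, F (Complex.exp (θ * Complex.I) • w) := by
    apply intervalIntegral_integral_swap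
    rw [Measure.prod_restrict]
    have hc : ContinuousOn (Function.uncurry fun (θ : ℝ) (w : EuclideanSpace ℂ (Fin n)) =>
        F (Complex.exp (θ * Complex.I) • w))
        (Set.uIcc 0 (2 * Real.pi) ×ˢ closedBall (0 : EuclideanSpace ℂ (Fin n)) δ) := by
      refine hF.continuousOn.comp (f := fun p : ℝ × EuclideanSpace ℂ (Fin n) =>
        Complex.exp (p.1 * Complex.I) • p.2) (by fun_prop) ?_
      rintro ⟨θ, w⟩ ⟨-, hw⟩
      apply hU
      simpa [norm_smul] using hw
    refine (hc.integrableOn_compact (isCompact_uIcc.prod (isCompact_closedBall _ _))).mono_set ?_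
    exact Set.prod_mono Set.uIoc_subset_uIcc ball_subset_closedBall
  rw [setIntegral_congr_fun measurableSet_ball hmean] at hswap
  simp only [hrot, intervalIntegral.integral_const, sub_zero, setIntegral_const] at hswap
  have h2 : (2 * Real.pi : ℝ) ≠ 0 := by positivity
  rw [smul_comm] at hswap
  simpa using smul_right_injective ℂ h2 hswap

/-- The mean value inequality over a ball inside the unit ball. -/
lemma mul_norm_le_setIntegral {n : ℕ} {F : EuclideanSpace ℂ (Fin n) → ℂ}
    (hF : DifferentiableOn ℂ F (ball 0 1)) (hi : IntegrableOn F (ball 0 1))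
    {z : EuclideanSpace ℂ (Fin n)} {δ : ℝ} (hz : closedBall z δ ⊆ ball 0 1) :
    volume.real (ball (0 : EuclideanSpace ℂ (Fin n)) δ) * ‖F z‖ ≤ ∫ w in ball 0 1, ‖F w‖ := by
  have hmaps : Set.MapsTo (fun w => z + w) (closedBall 0 δ) (ball 0 1) := by
    intro w hw
    have hw' : z + w ∈ closedBall z δ := by
      rw [mem_closedBall, dist_zero_right] at hw
      rwa [mem_closedBall, dist_self_add_left]
    exact hz hw'
  have hd : DifferentiableOn ℂ (fun w => F (z + w)) (closedBall 0 δ) :=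
    hF.comp (by fun_prop) hmaps
  have hm := setIntegral_ball_eq subset_rfl hd
  have hp := (measurePreserving_add_left volume z).setIntegral_preimage_emb
      (measurableEmbedding_addLeft z) F (ball z δ)
  have hpre : (fun w => z + w) ⁻¹' ball z δ = ball 0 δ := by
    ext w; simp
  rw [hpre, hm, add_zero] at hp
  calc _ = ‖∫ w in ball z δ, F w‖ := by
          rw [← hp, norm_mul, Complex.norm_real, Real.norm_of_nonneg measureReal_nonneg]
    _ ≤ ∫ w in ball z δ, ‖F w‖ := norm_integral_le_integral_norm _
    _ ≤ _ := setIntegral_mono_set hi.norm (ae_of_all _ fun _ => norm_nonneg _)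
      (ball_subset_closedBall.trans hz).eventuallyLE

/-- Holomorphic functions on the ball are controlled pointwise by their integral. -/
lemma norm_le_integral {n : ℕ} {F : EuclideanSpace ℂ (Fin n) → ℂ}
    (hF : DifferentiableOn ℂ F (ball 0 1)) (hi : Integrable F (ballMeasure n))
    {z : EuclideanSpace ℂ (Fin n)} {δ : ℝ} (hδ : 0 < δ) (hz : closedBall z δ ⊆ ball 0 1) :
    ‖F z‖ ≤ volume.real (ball (0 : EuclideanSpace ℂ (Fin n)) 1) /
      volume.real (ball (0 : EuclideanSpace ℂ (Fin n)) δ) * ∫ w, ‖F w‖ ∂(ballMeasure n) := by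
  have hV : 0 < volume.real (ball (0 : EuclideanSpace ℂ (Fin n)) 1) :=
    ENNReal.toReal_pos (measure_ball_pos volume _ one_pos).ne' measure_ball_lt_top.ne
  have hVδ : 0 < volume.real (ball (0 : EuclideanSpace ℂ (Fin n)) δ) :=
    ENNReal.toReal_pos (measure_ball_pos volume _ hδ).ne' measure_ball_lt_top.ne
  have hi' : IntegrableOn F (ball 0 1) :=
    (integrable_smul_measure (ENNReal.inv_ne_zero.2 measure_ball_lt_top.ne)
      (ENNReal.inv_ne_top.2 (measure_ball_pos volume _ one_pos).ne')).1 hi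
  have hint : ∫ w, ‖F w‖ ∂(ballMeasure n) =
      (volume.real (ball (0 : EuclideanSpace ℂ (Fin n)) 1))⁻¹ * ∫ w in ball 0 1, ‖F w‖ := by
    rw [ballMeasure, integral_smul_measure, ENNReal.toReal_inv, smul_eq_mul, Measure.real]
  have h1 := mul_norm_le_setIntegral hF hi' hz
  rw [hint]
  generalize volume.real (ball (0 : EuclideanSpace ℂ (Fin n)) 1) = V at *
  generalize volume.real (ball (0 : EuclideanSpace ℂ (Fin n)) δ) = W at *
  generalize ∫ w in ball 0 1, ‖F w‖ = I at *
  have : V / W * (V⁻¹ * I) = I / W := by field_simp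
  rw [this, le_div_iff₀ hVδ, mul_comm]
  exact h1

/-- Locally uniform control of a holomorphic function and of its derivative by its `L²` norm. -/
lemma exists_local_bound {n : ℕ} {x₀ : EuclideanSpace ℂ (Fin n)} (hx₀ : x₀ ∈ ball 0 1) :
    ∃ C r : ℝ, 0 < r ∧ ball x₀ r ⊆ ball 0 1 ∧
      ∀ (F : EuclideanSpace ℂ (Fin n) → ℂ) (φ : Lp ℂ 2 (ballMeasure n)),
        DifferentiableOn ℂ F (ball 0 1) → φ =ᵐ[ballMeasure n] F →
        ∀ x ∈ ball x₀ r, ‖F x‖ ≤ C * ‖φ‖ ∧ ‖fderiv ℂ F x‖ ≤ C * ‖φ‖ := by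
  obtain ⟨ε, hε, hεs⟩ := Metric.isOpen_iff.1 isOpen_ball x₀ hx₀
  set δ := ε / 4 with hδ
  have hδ0 : 0 < δ := by positivity
  set K := volume.real (ball (0 : EuclideanSpace ℂ (Fin n)) 1) /
      volume.real (ball (0 : EuclideanSpace ℂ (Fin n)) δ) with hK
  have hK0 : 0 ≤ K := by positivity
  refine ⟨max K (K / δ), δ, hδ0, (ball_subset_ball (by linarith)).trans hεs, ?_⟩
  intro F φ hF hφ
  have hmem : MemLp F 2 (ballMeasure n) := (memLp_congr_ae hφ).1 (Lp.memLp φ)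
  have hi : Integrable F (ballMeasure n) := hmem.integrable (by norm_num)
  have hL : ∫ w, ‖F w‖ ∂(ballMeasure n) ≤ ‖φ‖ := by
    have h := eLpNorm_le_eLpNorm_of_exponent_le (μ := ballMeasure n) (p := 1) (q := 2)
      (by norm_num) hmem.1
    rw [integral_norm_eq_lintegral_enorm hmem.1, ← eLpNorm_one_eq_lintegral_enorm, Lp.norm_def,
      eLpNorm_congr_ae hφ]
    exact ENNReal.toReal_mono hmem.2.ne h
  have hb : ∀ y, dist y x₀ ≤ 2 * δ → ‖F y‖ ≤ K * ‖φ‖ := by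
    intro y hy
    refine (norm_le_integral hF hi hδ0 ?_).trans (by gcongr)
    refine (fun w hw => hεs ?_)
    rw [mem_closedBall] at hw
    rw [mem_ball]
    have := dist_triangle w y x₀
    linarith
  intro x hx
  rw [mem_ball] at hx
  constructor
  · exact (hb x (by linarith)).trans (by gcongr; exact le_max_left _ _)
  · refine ContinuousLinearMap.opNorm_le_bound _ (by positivity) fun v => ?_
    have hxb : x ∈ ball (0 : EuclideanSpace ℂ (Fin n)) 1 :=
      hεs (by rw [mem_ball]; linarith)
    have hdx : DifferentiableAt ℂ F x := (hF x hxb).differentiableAt (isOpen_ball.mem_nhds hxb)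
    rcases eq_or_ne v 0 with rfl | hv
    · simp
    have hv0 : 0 < ‖v‖ := norm_pos_iff.2 hv
    have hR : 0 < δ / ‖v‖ := by positivity
    have hnear : ∀ t ∈ closedBall (0 : ℂ) (δ / ‖v‖), dist (x + t • v) x₀ ≤ 2 * δ := by
      intro t ht
      have h1 : ‖t‖ * ‖v‖ ≤ δ := by
        rw [mem_closedBall, dist_zero_right, le_div_iff₀ hv0] at ht
        exact ht
      have h2 := dist_triangle (x + t • v) x x₀
      rw [dist_self_add_left, norm_smul] at h2
      linarith
    have hdc : DiffContOnCl ℂ (fun t : ℂ => F (x + t • v)) (ball 0 (δ / ‖v‖)) := by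
      refine DifferentiableOn.diffContOnCl_ball (U := closedBall 0 (δ / ‖v‖)) ?_ subset_rfl
      refine hF.comp (by fun_prop) fun t ht => hεs ?_
      rw [mem_ball]
      have := hnear t ht
      linarith
    have hder := Complex.norm_deriv_le_of_forall_mem_sphere_norm_le hR hdc
      (C := K * ‖φ‖) (fun t ht => hb _ (hnear t (sphere_subset_closedBall ht)))
    have heq : deriv (fun t : ℂ => F (x + t • v)) 0 = fderiv ℂ F x v := by
      have hl : HasDerivAt (fun t : ℂ => x + t • v) v 0 := by
        simpa using ((hasDerivAt_id (0 : ℂ)).smul_const v).const_add x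
      have hdx' : HasFDerivAt F (fderiv ℂ F x) (x + (0 : ℂ) • v) := by
        simpa using hdx.hasFDerivAt
      exact (hdx'.comp_hasDerivAt (0 : ℂ) hl).deriv
    rw [heq] at hder
    calc _ ≤ K * ‖φ‖ / (δ / ‖v‖) := hder
      _ = K / δ * ‖φ‖ * ‖v‖ := by field_simp
      _ ≤ _ := by gcongr; exact le_max_right _ _

/-- The Bergman space `A²` of the unit ball: the (classes of) square-integrable functions that are
holomorphic in the ball, as a subspace of `L²`. -/
def bergmanSpace (n : ℕ) : Submodule ℂ (Lp ℂ 2 (ballMeasure n)) where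
  carrier := {φ | ∃ F : EuclideanSpace ℂ (Fin n) → ℂ,
    DifferentiableOn ℂ F (ball 0 1) ∧ φ =ᵐ[ballMeasure n] F}
  zero_mem' := ⟨0, differentiableOn_const _, Lp.coeFn_zero _ _ _⟩
  add_mem' := by
    rintro φ ψ ⟨F, hF, hφ⟩ ⟨G, hG, hψ⟩
    exact ⟨F + G, hF.add hG, (Lp.coeFn_add φ ψ).trans (hφ.add hψ)⟩
  smul_mem' := by
    rintro c φ ⟨F, hF, hφ⟩
    exact ⟨c • F, hF.const_smul c, (Lp.coeFn_smul c φ).trans (hφ.const_smul c)⟩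

/-- The Bergman space is closed in `L²`. -/
lemma isClosed_bergmanSpace (n : ℕ) :
    IsClosed (bergmanSpace n : Set (Lp ℂ 2 (ballMeasure n))) := by
  refine IsSeqClosed.isClosed ?_
  intro φ φ' hmem hlim
  choose F hF hφ using hmem
  have hcau : CauchySeq φ := hlim.cauchySeq
  have hsub : ∀ k l, ((φ k - φ l : Lp ℂ 2 (ballMeasure n)) :
      EuclideanSpace ℂ (Fin n) → ℂ) =ᵐ[ballMeasure n] F k - F l := fun k l =>
    (Lp.coeFn_sub _ _).trans ((hφ k).sub (hφ l))
  have key : ∀ x₀ ∈ ball (0 : EuclideanSpace ℂ (Fin n)) 1, ∃ C r : ℝ, 0 < r ∧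
      ball x₀ r ⊆ ball 0 1 ∧ ∀ k l, ∀ x ∈ ball x₀ r,
        dist (F k x) (F l x) ≤ C * dist (φ k) (φ l) ∧
        dist (fderiv ℂ (F k) x) (fderiv ℂ (F l) x) ≤ C * dist (φ k) (φ l) := by
    intro x₀ hx₀
    obtain ⟨C, r, hr, hs, hb⟩ := exists_local_bound hx₀
    refine ⟨C, r, hr, hs, fun k l x hx => ?_⟩
    have h := hb (F k - F l) (φ k - φ l) ((hF k).sub (hF l)) (hsub k l) x hx
    have hd : ∀ j, DifferentiableAt ℂ (F j) x := fun j =>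
      (hF j x (hs hx)).differentiableAt (isOpen_ball.mem_nhds (hs hx))
    rw [fderiv_sub (hd k) (hd l)] at h
    simpa only [dist_eq_norm, Pi.sub_apply] using h
  have hsmall : ∀ C : ℝ, ∀ ε > 0, ∃ N, ∀ k ≥ N, ∀ l ≥ N, C * dist (φ k) (φ l) < ε := by
    intro C ε hε
    obtain ⟨N, hN⟩ := Metric.cauchySeq_iff.1 hcau (ε / (|C| + 1)) (by positivity)
    refine ⟨N, fun k hk l hl => ?_⟩
    have h1 := hN k hk l hl
    rw [lt_div_iff₀ (by positivity)] at h1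
    have h2 : C * dist (φ k) (φ l) ≤ |C| * dist (φ k) (φ l) := by
      gcongr; exact le_abs_self C
    nlinarith [dist_nonneg (x := φ k) (y := φ l)]
  have hpt : ∀ x ∈ ball (0 : EuclideanSpace ℂ (Fin n)) 1, CauchySeq (fun k => F k x) := by
    intro x hx
    obtain ⟨C, r, hr, -, hb⟩ := key x hx
    refine Metric.cauchySeq_iff.2 fun ε hε => ?_
    obtain ⟨N, hN⟩ := hsmall C ε hε
    exact ⟨N, fun k hk l hl => (hb k l x (mem_ball_self hr)).1.trans_lt (hN k hk l hl)⟩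
  have hpt' : ∀ x ∈ ball (0 : EuclideanSpace ℂ (Fin n)) 1,
      CauchySeq (fun k => fderiv ℂ (F k) x) := by
    intro x hx
    obtain ⟨C, r, hr, -, hb⟩ := key x hx
    refine Metric.cauchySeq_iff.2 fun ε hε => ?_
    obtain ⟨N, hN⟩ := hsmall C ε hε
    exact ⟨N, fun k hk l hl => (hb k l x (mem_ball_self hr)).2.trans_lt (hN k hk l hl)⟩
  have hex : ∀ x, ∃ y, x ∈ ball (0 : EuclideanSpace ℂ (Fin n)) 1 →
      Tendsto (fun k => F k x) atTop (𝓝 y) := by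
    intro x
    by_cases hx : x ∈ ball (0 : EuclideanSpace ℂ (Fin n)) 1
    · obtain ⟨y, hy⟩ := cauchySeq_tendsto_of_complete (hpt x hx)
      exact ⟨y, fun _ => hy⟩
    · exact ⟨0, fun h => absurd h hx⟩
  have hex' : ∀ x, ∃ y, x ∈ ball (0 : EuclideanSpace ℂ (Fin n)) 1 →
      Tendsto (fun k => fderiv ℂ (F k) x) atTop (𝓝 y) := by
    intro x
    by_cases hx : x ∈ ball (0 : EuclideanSpace ℂ (Fin n)) 1
    · obtain ⟨y, hy⟩ := cauchySeq_tendsto_of_complete (hpt' x hx)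
      exact ⟨y, fun _ => hy⟩
    · exact ⟨0, fun h => absurd h hx⟩
  choose G hG using hex
  choose G' hG' using hex'
  have hunif : TendstoLocallyUniformlyOn (fun k => fderiv ℂ (F k)) G' atTop (ball 0 1) := by
    rw [Metric.tendstoLocallyUniformlyOn_iff]
    intro ε hε x hx
    obtain ⟨C, r, hr, hs, hb⟩ := key x hx
    obtain ⟨N, hN⟩ := hsmall C (ε / 2) (by positivity)
    refine ⟨ball x r, mem_nhdsWithin_of_mem_nhds (ball_mem_nhds x hr), ?_⟩
    filter_upwards [eventually_ge_atTop N] with k hk y hy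
    have hl : Tendsto (fun l => dist (fderiv ℂ (F l) y) (fderiv ℂ (F k) y)) atTop
        (𝓝 (dist (G' y) (fderiv ℂ (F k) y))) := (hG' y (hs hy)).dist tendsto_const_nhds
    have hle : dist (G' y) (fderiv ℂ (F k) y) ≤ ε / 2 := by
      refine le_of_tendsto hl ?_
      filter_upwards [eventually_ge_atTop N] with l hl
      exact ((hb l k y hy).2.trans_lt (hN l hl k hk)).le
    linarith
  refine ⟨G, fun x hx => ?_, ?_⟩
  · have h := hasFDerivAt_of_tendstoLocallyUniformlyOn isOpen_ball hunif
      (fun k y hy => ((hF k y hy).differentiableAt (isOpen_ball.mem_nhds hy)).hasFDerivAt)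
      (fun y hy => hG y hy) hx
    exact h.differentiableAt.differentiableWithinAt
  · obtain ⟨ns, hns, hae⟩ := (tendstoInMeasure_of_tendsto_Lp hlim).exists_seq_tendsto_ae
    have hball : ∀ᵐ x ∂(ballMeasure n), x ∈ ball (0 : EuclideanSpace ℂ (Fin n)) 1 :=
      Measure.ae_smul_measure (ae_restrict_mem measurableSet_ball) _
    filter_upwards [hae, hball, ae_all_iff.2 hφ] with x h1 h2 h3
    have h4 : Tendsto (fun i => F (ns i) x) atTop (𝓝 (φ' x)) := by
      simpa only [h3] using h1
    exact tendsto_nhds_unique h4 ((hG x h2).comp hns.tendsto_atTop)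

instance bergmanSpace_completeSpace (n : ℕ) : CompleteSpace (bergmanSpace n) :=
  (isClosed_bergmanSpace n).completeSpace_coe

/-- The orthogonal projection `P` of `L²` onto the Bergman space. -/
def bergmanProjection (n : ℕ) : Lp ℂ 2 (ballMeasure n) →L[ℂ] bergmanSpace n :=
  (bergmanSpace n).orthogonalProjectionOnto

/-- The bounded holomorphic functions on the ball, as a subspace of the Bergman space. -/
def boundedHolomorphic (n : ℕ) : Submodule ℂ (bergmanSpace n) where
  carrier := {φ | ∃ F : EuclideanSpace ℂ (Fin n) → ℂ,
    DifferentiableOn ℂ F (ball 0 1) ∧ (∃ C : ℝ, ∀ z ∈ ball 0 1, ‖F z‖ ≤ C) ∧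
      (φ : Lp ℂ 2 (ballMeasure n)) =ᵐ[ballMeasure n] F}
  zero_mem' := ⟨0, differentiableOn_const _, ⟨0, by simp⟩, Lp.coeFn_zero _ _ _⟩
  add_mem' := by
    rintro φ ψ ⟨F, hF, ⟨C, hC⟩, hφ⟩ ⟨G, hG, ⟨D, hD⟩, hψ⟩
    exact ⟨F + G, hF.add hG,
      ⟨C + D, fun z hz => (norm_add_le _ _).trans (add_le_add (hC z hz) (hD z hz))⟩,
      (Lp.coeFn_add _ _).trans (hφ.add hψ)⟩
  smul_mem' := by
    rintro c φ ⟨F, hF, ⟨C, hC⟩, hφ⟩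
    refine ⟨c • F, hF.const_smul c, ⟨‖c‖ * C, fun z hz => ?_⟩,
      (Lp.coeFn_smul c _).trans (hφ.const_smul c)⟩
    rw [Pi.smul_apply, norm_smul]
    exact mul_le_mul_of_nonneg_left (hC z hz) (norm_nonneg c)

/-- If `f` is (essentially) bounded and `φ ∈ L²`, then `f φ ∈ L²`. -/
lemma memLp_mul_of_bounded {n : ℕ} {f : EuclideanSpace ℂ (Fin n) → ℂ}
    (hf : MemLp f ∞ (ballMeasure n)) (φ : Lp ℂ 2 (ballMeasure n)) :
    MemLp (fun z => f z * φ z) 2 (ballMeasure n) :=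
  (Lp.memLp φ).mul hf

/-- If `f ∈ L²` and `φ` is bounded and holomorphic, then `f φ ∈ L²`. -/
lemma memLp_mul_of_boundedHolomorphic {n : ℕ} {f : EuclideanSpace ℂ (Fin n) → ℂ}
    (hf : MemLp f 2 (ballMeasure n)) {φ : bergmanSpace n} (hφ : φ ∈ boundedHolomorphic n) :
    MemLp (fun z => f z * (φ : Lp ℂ 2 (ballMeasure n)) z) 2 (ballMeasure n) := by
  obtain ⟨F, -, ⟨C, hC⟩, hae⟩ := hφ
  have hball : ∀ᵐ x ∂(ballMeasure n), x ∈ ball (0 : EuclideanSpace ℂ (Fin n)) 1 :=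
    Measure.ae_smul_measure (ae_restrict_mem measurableSet_ball) _
  have hb : MemLp (φ : Lp ℂ 2 (ballMeasure n)) ∞ (ballMeasure n) := by
    refine memLp_top_of_bound (Lp.memLp _).1 C ?_
    filter_upwards [hae, hball] with z h1 h2
    rw [h1]
    exact hC z h2
  exact hb.mul hf

/-- The Toeplitz operator `T_f φ = P (f φ)` with bounded symbol `f`, defined on all of `A²`. -/
def toeplitzBounded {n : ℕ} (f : EuclideanSpace ℂ (Fin n) → ℂ)
    (hf : MemLp f ∞ (ballMeasure n)) : bergmanSpace n →ₗ[ℂ] bergmanSpace n where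
  toFun φ := bergmanProjection n ((memLp_mul_of_bounded hf φ).toLp _)
  map_add' φ ψ := by
    rw [← map_add, ← MemLp.toLp_add]
    congr 1
    refine MemLp.toLp_congr _ _ ?_
    filter_upwards [Lp.coeFn_add (φ : Lp ℂ 2 (ballMeasure n)) ψ] with z hz
    simp only [Submodule.coe_add, hz, Pi.add_apply, mul_add]
  map_smul' c φ := by
    rw [RingHom.id_apply, ← map_smul, ← MemLp.toLp_const_smul]
    congr 1
    refine MemLp.toLp_congr _ _ ?_
    filter_upwards [Lp.coeFn_smul c (φ : Lp ℂ 2 (ballMeasure n))] with z hz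
    simp only [Submodule.coe_smul, hz, Pi.smul_apply, smul_eq_mul, mul_left_comm]

/-- The Toeplitz operator `T_f φ = P (f φ)` with symbol `f ∈ L²`, whose domain consists of the
bounded holomorphic functions. -/
def toeplitz {n : ℕ} (f : EuclideanSpace ℂ (Fin n) → ℂ)
    (hf : MemLp f 2 (ballMeasure n)) : bergmanSpace n →ₗ.[ℂ] bergmanSpace n where
  domain := boundedHolomorphic n
  toFun :=
    { toFun := fun φ => bergmanProjection n ((memLp_mul_of_boundedHolomorphic hf φ.2).toLp _)
      map_add' := fun φ ψ => by
        rw [← map_add, ← MemLp.toLp_add]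
        congr 1
        refine MemLp.toLp_congr _ _ ?_
        filter_upwards [Lp.coeFn_add ((φ : bergmanSpace n) : Lp ℂ 2 (ballMeasure n))
          (ψ : bergmanSpace n)] with z hz
        simp only [Submodule.coe_add, hz, Pi.add_apply, mul_add]
      map_smul' := fun c φ => by
        rw [RingHom.id_apply, ← map_smul, ← MemLp.toLp_const_smul]
        congr 1
        refine MemLp.toLp_congr _ _ ?_
        filter_upwards [Lp.coeFn_smul c ((φ : bergmanSpace n) : Lp ℂ 2 (ballMeasure n))]
          with z hz
        simp only [Submodule.coe_smul, hz, Pi.smul_apply, smul_eq_mul, mul_left_comm] }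

/-- The product `T_{f₁} ⋯ T_{f_N}` of Toeplitz operators with bounded symbols, in this order
(the rightmost operator acts first; the empty product is the identity). -/
def toeplitzProd {n N : ℕ} (f : Fin N → EuclideanSpace ℂ (Fin n) → ℂ)
    (hf : ∀ i, MemLp (f i) ∞ (ballMeasure n)) : Module.End ℂ (bergmanSpace n) :=
  (List.ofFn fun i => toeplitzBounded (f i) (hf i)).prod

/-- The product `A T B` of an unbounded operator `T` with everywhere defined operators `A` and `B`,
on its natural domain `{φ | B φ ∈ dom T}`. -/
def sandwich {V : Type*} [AddCommGroup V] [Module ℂ V] (A : Module.End ℂ V) (T : V →ₗ.[ℂ] V)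
    (B : Module.End ℂ V) : V →ₗ.[ℂ] V where
  domain := T.domain.comap B
  toFun := A ∘ₗ T.toFun ∘ₗ B.restrict (p := T.domain.comap B) (q := T.domain) fun _ h => h

/-- The product `T_{f₁} ⋯ T_{f_N} T_u T_{g₁} ⋯ T_{g_M}` with `u ∈ L²` and all other symbols
bounded. Its domain consists of the `φ ∈ A²` such that `T_{g₁} ⋯ T_{g_M} φ` is bounded. -/
def toeplitzProduct {n N M : ℕ} (f : Fin N → EuclideanSpace ℂ (Fin n) → ℂ)
    (hf : ∀ i, MemLp (f i) ∞ (ballMeasure n))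
    (u : EuclideanSpace ℂ (Fin n) → ℂ) (hu : MemLp u 2 (ballMeasure n))
    (g : Fin M → EuclideanSpace ℂ (Fin n) → ℂ)
    (hg : ∀ i, MemLp (g i) ∞ (ballMeasure n)) : bergmanSpace n →ₗ.[ℂ] bergmanSpace n :=
  sandwich (toeplitzProd f hf) (toeplitz u hu) (toeplitzProd g hg)

/-- A function on the unit ball is radial if `f z = f̃ |z|` there for some `f̃`. -/
def IsRadial {n : ℕ} (f : EuclideanSpace ℂ (Fin n) → ℂ) : Prop :=
  ∃ h : ℝ → ℂ, ∀ z ∈ ball (0 : EuclideanSpace ℂ (Fin n)) 1, f z = h ‖z‖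

end BergmanBall

end

/-! A Toeplitz operator with radial symbol `f` multiplies every homogeneous holomorphic function of
degree `k` by the ratio of `∫ f |z|^(2k)` to `∫ |z|^(2k)`: polar coordinates separate `f` from the
spherical part, and rotations make different degrees orthogonal (`toeplitzBounded_toBergman`). With
`t = -2 log |z|` these moments are values at `s = k` of a Laplace transform, bounded and holomorphic
for `Re s > 0`. By the Blaschke condition, its zeros at natural numbers have summable reciprocals
(form a thin set) unless it vanishes identically, and then `f = 0` a.e.

Hence the products `A` and `B` on the two sides of `T_u` are diagonal, with eigenvalues `a` and `b`
vanishing only on a thin set. For homogeneous `q` and `p` of degrees `k` and `l`, pairing `A T_u B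
q` with `p` gives `a l * b k * ∫ u q p̄`, so if the product is zero the mixed moments of `u` vanish
whenever `k` and `l` avoid a thin set `Z`.

The exceptional degrees are removed in `ae_eq_zero_of_moments_off_thin`. Since `|z|^(2m) = (∑
|z_i|²)^m` raises both degrees by `m`, the integral `∫ u q p̄ |z|^(2m)` vanishes for all `m` with `k
+ m` and `l + m` outside `Z`. By divergence of the harmonic series such `m` do not form a thin set,
so the Laplace argument, now for the integrable function `u q p̄`, yields the case `m = 0`. All
mixed moments of `u` vanish, and Stone–Weierstrass gives `u = 0` a.e.

Density of the domain follows because it contains the homogeneous holomorphic functions, and these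
span a dense subspace of the Bergman space. -/

/-! ### Thin sets of natural numbers. -/

/-- A set of natural numbers over which the sum of the reciprocals converges. -/
def ThinSet (S : Set ℕ) : Prop := Summable (S.indicator fun k : ℕ => (k : ℝ)⁻¹)

namespace ThinSet

lemma mono {S T : Set ℕ} (hT : ThinSet T) (h : S ⊆ T) : ThinSet S := by
  refine Summable.of_nonneg_of_le (fun k => ?_) (fun k => ?_) hT
  · exact Set.indicator_nonneg (fun _ _ => by positivity) _
  · exact Set.indicator_le_indicator_of_subset h (fun _ => by positivity) _

lemma union {S T : Set ℕ} (hS : ThinSet S) (hT : ThinSet T) : ThinSet (S ∪ T) := by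
  refine Summable.of_nonneg_of_le (fun k => ?_) (fun k => ?_) (hS.add hT)
  · exact Set.indicator_nonneg (fun _ _ => by positivity) _
  · have h1 : (0 : ℝ) ≤ (k : ℝ)⁻¹ := by positivity
    by_cases hs : k ∈ S <;> by_cases ht : k ∈ T <;> simp [hs, ht, h1]

lemma of_finite {S : Set ℕ} (hS : S.Finite) : ThinSet S :=
  summable_of_hasFiniteSupport (hS.subset Set.support_indicator_subset)

/-- Comparison: `k + a ≤ (a + 1) k` for `k ≥ 1`, so `1/k ≤ (a + 1)/(k + a)`. -/
lemma preimage_add {S : Set ℕ} (hS : ThinSet S) (a : ℕ) : ThinSet {m | m + a ∈ S} := by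
  have h := (hS.comp_injective (add_left_injective a)).mul_left ((a : ℝ) + 1)
  refine Summable.of_nonneg_of_le (fun k => ?_) (fun k => ?_) h
  · exact Set.indicator_nonneg (fun _ _ => by positivity) _
  · by_cases hk : k + a ∈ S
    · simp only [Set.indicator, Set.mem_ofPred_eq, hk, if_true, Function.comp_apply]
      -- At `k = 0` the left side is `0⁻¹ = 0`, so membership of `0` never affects thinness.
      rcases Nat.eq_zero_or_pos k with rfl | hk0
      · simp; positivity
      · have : (1 : ℝ) ≤ k := by exact_mod_cast hk0
        push_cast
        rw [← div_eq_mul_inv, inv_eq_one_div, div_le_div_iff₀ (by positivity) (by positivity)]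
        nlinarith [(Nat.cast_nonneg a : (0 : ℝ) ≤ a)]
    · simp [Set.indicator, hk]

lemma not_compl {S : Set ℕ} (hS : ThinSet S) : ¬ ThinSet Sᶜ := by
  intro h
  have h1 := hS.union h
  rw [Set.union_compl_self, ThinSet, Set.indicator_univ] at h1
  exact Real.not_summable_natCast_inv h1

end ThinSet

/-! ### Zeros of bounded holomorphic functions on the right half plane. -/

/-- A bounded holomorphic function on the right half plane which vanishes at `l > 0` is divisible
by the corresponding Blaschke factor without increasing the bound. -/
lemma exists_eq_blaschkeFactor_mul {Φ : ℂ → ℂ} {M l : ℝ} (hl : 0 < l)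
    (hd : DifferentiableOn ℂ Φ {s | 0 < s.re}) (hM : ∀ s : ℂ, 0 < s.re → ‖Φ s‖ ≤ M)
    (h0 : Φ l = 0) :
    ∃ Ψ : ℂ → ℂ, DifferentiableOn ℂ Ψ {s | 0 < s.re} ∧ (∀ s : ℂ, 0 < s.re → ‖Ψ s‖ ≤ M) ∧
      ∀ s : ℂ, 0 < s.re → Φ s = (s - l) / (s + l) * Ψ s := by
  have hne : ∀ w ∈ ball (0 : ℂ) 1, (1 - w) ≠ 0 := by
    intro w hw h
    rw [sub_eq_zero] at h
    simp [← h] at hw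
  -- The Cayley map `w ↦ l (1 + w)/(1 - w)` takes the disc to the half plane and `0` to `l`. Its
  -- real part is a positive multiple of `1 - |w|²`.
  have hre : ∀ w ∈ ball (0 : ℂ) 1, 0 < ((l : ℂ) * (1 + w) / (1 - w)).re := by
    intro w hw
    have h1 : (l : ℂ) * (1 + w) / (1 - w) =
        ((l / Complex.normSq (1 - w) : ℝ) : ℂ) * ((1 + w) * (starRingEnd ℂ) (1 - w)) := by
      have h3 := Complex.mul_conj (1 - w)
      have h4 : (starRingEnd ℂ) (1 - w) ≠ 0 := (map_ne_zero _).2 (hne w hw)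
      rw [Complex.ofReal_div, ← h3]
      have := hne w hw
      field_simp
    rw [h1, Complex.re_ofReal_mul]
    have h2 : 0 < Complex.normSq (1 - w) := Complex.normSq_pos.2 (hne w hw)
    refine mul_pos (by positivity) ?_
    have hw1 : Complex.normSq w < 1 := by
      rw [Complex.normSq_eq_norm_sq]
      rw [mem_ball_zero_iff] at hw
      nlinarith [norm_nonneg w]
    rw [Complex.normSq_apply] at hw1
    simp
    nlinarith
  have hpos : ∀ s : ℂ, 0 < s.re → s + l ≠ 0 := by
    intro s hs h
    have := congrArg Complex.re h
    simp at this
    linarith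
  have hlt : ∀ s : ℂ, 0 < s.re → (s - l) / (s + l) ∈ ball (0 : ℂ) 1 := by
    intro s hs
    rw [mem_ball_zero_iff, norm_div, div_lt_one (norm_pos_iff.2 (hpos s hs)), ← sq_lt_sq₀
      (norm_nonneg _) (norm_nonneg _), ← Complex.normSq_eq_norm_sq, ← Complex.normSq_eq_norm_sq,
      Complex.normSq_apply, Complex.normSq_apply]
    simp
    nlinarith
  set g : ℂ → ℂ := fun w => Φ (l * (1 + w) / (1 - w)) with hg
  have hgd : DifferentiableOn ℂ g (ball 0 1) := by
    refine hd.comp ?_ hre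
    refine DifferentiableOn.div (by fun_prop) (by fun_prop) hne
  have hg0 : g 0 = 0 := by simp [hg, h0]
  have hmaps : Set.MapsTo g (ball 0 1) (closedBall (g 0) M) := by
    intro w hw
    rw [hg0, mem_closedBall_zero_iff]
    exact hM _ (hre w hw)
  -- Since `g 0 = 0`, the slope `dslope g 0` is `g w / w` with its singularity removed, and the
  -- Schwarz lemma bounds it by `M`. Pulled back to the half plane, it is the required quotient.
  have hds : DifferentiableOn ℂ (dslope g 0) (ball 0 1) :=
    (Complex.differentiableOn_dslope (ball_mem_nhds _ one_pos)).2 hgd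
  refine ⟨fun s => dslope g 0 ((s - l) / (s + l)), ?_, fun s hs => ?_, fun s hs => ?_⟩
  · refine hds.comp ?_ hlt
    exact DifferentiableOn.div (by fun_prop) (by fun_prop) hpos
  · simpa using Complex.norm_dslope_le_div_of_mapsTo_ball hgd hmaps (hlt s hs)
  · have h1 := sub_smul_dslope g 0 ((s - l) / (s + l))
    rw [sub_zero, hg0, sub_zero, smul_eq_mul] at h1
    rw [h1, hg]
    have h2 := hpos s hs
    have hl' : (l : ℂ) ≠ 0 := by exact_mod_cast hl.ne'
    congr 1
    have h3 : 1 - (s - l) / (s + l) = 2 * l / (s + l) := by field_simp; ring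
    have h4 : 1 + (s - l) / (s + l) = 2 * s / (s + l) := by field_simp; ring
    rw [h3, h4]
    field_simp

/-- The zeros are divided out one at a time. The Blaschke factor of one zero does not vanish at the
others, so the quotient keeps the remaining zeros and the bound `M`. -/
lemma norm_le_mul_prod_blaschkeFactor (Λ : Finset ℝ) (hΛ : ∀ l ∈ Λ, 0 < l) :
    ∀ (Φ : ℂ → ℂ) (M : ℝ), DifferentiableOn ℂ Φ {s | 0 < s.re} →
      (∀ s : ℂ, 0 < s.re → ‖Φ s‖ ≤ M) → (∀ l ∈ Λ, Φ (l : ℝ) = 0) →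
      ∀ s : ℂ, 0 < s.re → ‖Φ s‖ ≤ M * ∏ l ∈ Λ, ‖(s - l) / (s + l)‖ := by
  induction Λ using Finset.cons_induction with
  | empty => intro Φ M _ hM _ s hs; simpa using hM s hs
  | cons a Λ ha ih =>
    intro Φ M hd hM h0 s hs
    have ha0 : 0 < a := hΛ a (Finset.mem_cons_self a Λ)
    obtain ⟨Ψ, hΨd, hΨM, hΨ⟩ := exists_eq_blaschkeFactor_mul ha0 hd hM
      (h0 a (Finset.mem_cons_self a Λ))
    have hΨ0 : ∀ l ∈ Λ, Ψ (l : ℝ) = 0 := by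
      intro l hl
      have hl0 : 0 < l := hΛ l (Finset.mem_cons_of_mem hl)
      have h1 := hΨ l (by simpa using hl0)
      rw [h0 l (Finset.mem_cons_of_mem hl)] at h1
      have h2 : ((l : ℂ) - a) / (l + a) ≠ 0 := by
        rw [← Complex.ofReal_sub, ← Complex.ofReal_add]
        refine div_ne_zero ?_ ?_
        · rw [Complex.ofReal_ne_zero, sub_ne_zero]
          rintro rfl; exact ha hl
        · rw [Complex.ofReal_ne_zero]; positivity
      exact (mul_eq_zero.1 h1.symm).resolve_left h2
    have h := ih (fun l hl => hΛ l (Finset.mem_cons_of_mem hl)) Ψ M hΨd hΨM hΨ0 s hs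
    rw [hΨ s hs, norm_mul, Finset.prod_cons]
    calc _ ≤ ‖(s - a) / (s + a)‖ * (M * ∏ l ∈ Λ, ‖(s - l) / (s + l)‖) := by gcongr
      _ = _ := by ring

/-- The zeros of a nonzero bounded holomorphic function on the right half plane at natural numbers
form a thin set. -/
lemma eq_zero_of_zeros_not_thin {Φ : ℂ → ℂ} {M : ℝ} {S : Set ℕ}
    (hd : DifferentiableOn ℂ Φ {s | 0 < s.re}) (hM : ∀ s : ℂ, 0 < s.re → ‖Φ s‖ ≤ M)
    (hS : ¬ ThinSet S) (h0 : ∀ m ∈ S, Φ (m : ℕ) = 0) {x : ℝ} (hx : 0 < x) : Φ x = 0 := by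
  by_contra hne
  have hc : 0 < ‖Φ x‖ := norm_pos_iff.2 hne
  have hM0 : 0 < M := hc.trans_le (hM x (by simpa using hx))
  obtain ⟨N, hN⟩ := exists_nat_gt x
  apply hS
  have hfin : ThinSet (Set.Iio N) := ThinSet.of_finite (Set.finite_Iio N)
  suffices h : ThinSet (S ∩ Set.Ici N) from
    (h.union hfin).mono fun k hk => by
      by_cases hkN : k < N
      · exact Or.inr hkN
      · exact Or.inl ⟨hk, not_lt.1 hkN⟩
  -- The bound on the partial sums comes from taking logarithms in `‖Φ x‖ ≤ M exp(-x ∑ 1/k)`, the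
  -- sum running over finitely many zeros `k ≥ N > x`.
  refine summable_of_sum_le (c := Real.log (M / ‖Φ x‖) / x)
    (fun k => Set.indicator_nonneg (fun _ _ => by positivity) _) fun F => ?_
  classical
  rw [← Finset.sum_filter_add_sum_filter_not F (· ∈ S ∩ Set.Ici N),
    Finset.sum_eq_zero (s := F.filter (¬ · ∈ S ∩ Set.Ici N)) (fun k hk =>
      Set.indicator_of_notMem (Finset.mem_filter.1 hk).2 _), add_zero,
    Finset.sum_congr rfl (fun k hk => Set.indicator_of_mem (Finset.mem_filter.1 hk).2 _)]
  set G := F.filter (· ∈ S ∩ Set.Ici N) with hG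
  have hGx : ∀ k ∈ G, x < k := fun k hk => by
    have h1 : N ≤ k := (Finset.mem_filter.1 hk).2.2
    have h2 : (N : ℝ) ≤ k := by exact_mod_cast h1
    linarith
  have hGS : ∀ k ∈ G, k ∈ S := fun k hk => (Finset.mem_filter.1 hk).2.1
  have hb := norm_le_mul_prod_blaschkeFactor (G.map Nat.castEmbedding)
    (by
      intro l hl
      obtain ⟨k, hk, rfl⟩ := Finset.mem_map.1 hl
      exact hx.trans (hGx k hk)) Φ M hd hM
    (by
      intro l hl
      obtain ⟨k, hk, rfl⟩ := Finset.mem_map.1 hl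
      simpa using h0 k (hGS k hk)) x (by simpa using hx)
  rw [Finset.prod_map] at hb
  have hp : ∏ k ∈ G, ‖((x : ℂ) - ((Nat.castEmbedding k : ℝ) : ℂ)) /
      (x + ((Nat.castEmbedding k : ℝ) : ℂ))‖ ≤ ∏ k ∈ G, Real.exp (-(x * (k : ℝ)⁻¹)) := by
    refine Finset.prod_le_prod (fun _ _ => norm_nonneg _) fun k hk => ?_
    have hk := hGx k hk
    have hk0 : (0 : ℝ) < k := hx.trans hk
    rw [← Complex.ofReal_sub, ← Complex.ofReal_add, ← Complex.ofReal_div, Complex.norm_real,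
      Real.norm_eq_abs, Nat.castEmbedding_apply, abs_div, abs_of_neg (by linarith),
      abs_of_pos (by linarith)]
    -- As `k > x`, `(k - x)/(k + x) = 1 - 2x/(k + x) ≤ 1 - x/k ≤ exp(-x/k)`.
    refine le_trans ?_ (Real.add_one_le_exp _)
    rw [div_le_iff₀ (by linarith)]
    field_simp
    nlinarith
  rw [← Real.exp_sum, Finset.sum_neg_distrib, ← Finset.mul_sum] at hp
  have h1 : ‖Φ x‖ ≤ M * Real.exp (-(x * ∑ k ∈ G, (k : ℝ)⁻¹)) :=
    hb.trans (by gcongr)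
  rw [Real.exp_neg, ← div_eq_mul_inv, le_div_iff₀ (Real.exp_pos _)] at h1
  rw [le_div_iff₀ hx, Real.le_log_iff_exp_le (by positivity), le_div_iff₀ hc, mul_comm _ x]
  linarith

/-! ### Laplace transforms and a Müntz type uniqueness theorem. -/

section Laplace

variable {α : Type*} [MeasurableSpace α] {μ : Measure α} {v : α → ℂ} {t : α → ℝ}

lemma norm_exp_neg_mul_le_one {s : ℂ} (hs : 0 ≤ s.re) {y : ℝ} (hy : 0 ≤ y) :
    ‖Complex.exp (-(s * y))‖ ≤ 1 := by
  rw [Complex.norm_exp, Real.exp_le_one_iff]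
  simp
  positivity

lemma integrable_mul_exp_neg (hv : Integrable v μ) (ht : AEMeasurable t μ) (h0 : ∀ᵐ a ∂μ, 0 ≤ t a)
    {s : ℂ} (hs : 0 ≤ s.re) : Integrable (fun a => v a * Complex.exp (-(s * t a))) μ := by
  refine hv.mul_bdd (c := 1) ?_ ?_
  · exact AEMeasurable.aestronglyMeasurable (by fun_prop)
  · filter_upwards [h0] with a ha using norm_exp_neg_mul_le_one hs ha

/-- Differentiation under the integral: where `Re z > ε = Re s / 2`, the extra factor is dominated
through `t exp(-ε t) ≤ 1/ε`. -/
lemma differentiableOn_laplace (hv : Integrable v μ) (ht : AEMeasurable t μ)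
    (h0 : ∀ᵐ a ∂μ, 0 ≤ t a) :
    DifferentiableOn ℂ (fun s : ℂ => ∫ a, v a * Complex.exp (-(s * t a)) ∂μ) {s | 0 < s.re} := by
  intro s hs
  set ε := s.re / 2 with hε
  have hs' : 0 < s.re := hs
  have hε0 : 0 < ε := by positivity
  have hU : {z : ℂ | ε < z.re} ∈ 𝓝 s :=
    (isOpen_lt continuous_const Complex.continuous_re).mem_nhds (by
      simp only [Set.mem_ofPred_eq]; linarith)
  refine (hasDerivAt_integral_of_dominated_loc_of_deriv_le (μ := μ)
    (F := fun (s : ℂ) a => v a * Complex.exp (-(s * t a)))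
    (F' := fun (s : ℂ) a => v a * (Complex.exp (-(s * t a)) * (-(t a))))
    (bound := fun a => ‖v a‖ * ε⁻¹) hU ?_ ?_ ?_ ?_ ?_ ?_).2.differentiableAt.differentiableWithinAt
  · filter_upwards [hU] with z hz
    exact (integrable_mul_exp_neg hv ht h0 (hε0.trans hz).le).1
  · exact integrable_mul_exp_neg hv ht h0 hs'.le
  · exact hv.1.mul (AEMeasurable.aestronglyMeasurable (by fun_prop))
  · filter_upwards [h0] with a ha z hz
    rw [norm_mul, norm_mul, norm_neg, Complex.norm_real, Real.norm_of_nonneg ha, Complex.norm_exp]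
    refine mul_le_mul_of_nonneg_left ?_ (norm_nonneg _)
    have h1 : (-(z * (t a : ℂ))).re ≤ -(ε * t a) := by
      simp
      exact mul_le_mul_of_nonneg_right hz.le ha
    calc _ ≤ Real.exp (-(ε * t a)) * t a := by gcongr
      _ ≤ ε⁻¹ := by
        rw [Real.exp_neg, inv_mul_le_iff₀ (Real.exp_pos _), ← div_eq_mul_inv, le_div_iff₀ hε0]
        linarith [Real.add_one_le_exp (ε * t a)]
  · exact hv.norm.mul_const _
  · refine ae_of_all _ fun a z _ => ?_
    have h1 : HasDerivAt (fun z : ℂ => -(z * (t a : ℂ))) (-(t a : ℂ)) z := by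
      exact (hasDerivAt_mul_const (t a : ℂ)).fun_neg
    exact h1.cexp.const_mul (v a)

/-- A Müntz type theorem: a Laplace transform which vanishes at the points of a set of natural
numbers that is not thin vanishes on the half line. -/
lemma laplace_eq_zero_of_not_thin (hv : Integrable v μ) (ht : AEMeasurable t μ)
    (h0 : ∀ᵐ a ∂μ, 0 ≤ t a) {S : Set ℕ} (hS : ¬ ThinSet S)
    (hz : ∀ m ∈ S, ∫ a, v a * Complex.exp (-((m : ℂ) * t a)) ∂μ = 0) {x : ℝ} (hx : 0 ≤ x) :
    ∫ a, v a * Complex.exp (-((x : ℂ) * t a)) ∂μ = 0 := by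
  have hpos : ∀ y : ℝ, 0 < y → ∫ a, v a * Complex.exp (-((y : ℂ) * t a)) ∂μ = 0 := by
    intro y hy
    refine eq_zero_of_zeros_not_thin (M := ∫ a, ‖v a‖ ∂μ) (differentiableOn_laplace hv ht h0)
      (fun s hs => ?_) hS hz hy
    refine norm_integral_le_of_norm_le hv.norm ?_
    filter_upwards [h0] with a ha
    rw [norm_mul]
    exact mul_le_of_le_one_right (norm_nonneg _) (norm_exp_neg_mul_le_one hs.le ha)
  -- The boundary point `0` lies outside the domain of holomorphy and is reached along `1/(k + 1)`
  -- by dominated convergence. It is the point that recovers the moment of order zero.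
  rcases hx.eq_or_lt with rfl | hx
  · have hlim : Tendsto (fun k : ℕ => ∫ a, v a *
        Complex.exp (-(((1 / ((k : ℝ) + 1) : ℝ) : ℂ) * t a)) ∂μ) atTop
        (𝓝 (∫ a, v a * Complex.exp (-(((0 : ℝ) : ℂ) * t a)) ∂μ)) := by
      refine tendsto_integral_of_dominated_convergence (fun a => ‖v a‖) (fun k => ?_) hv.norm
        (fun k => ?_) (ae_of_all _ fun a => ?_)
      · refine (integrable_mul_exp_neg hv ht h0 ?_).1
        rw [Complex.ofReal_re]; positivity
      · filter_upwards [h0] with a ha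
        rw [norm_mul]
        refine mul_le_of_le_one_right (norm_nonneg _) (norm_exp_neg_mul_le_one ?_ ha)
        rw [Complex.ofReal_re]; positivity
      · have hc : Continuous fun y : ℝ => v a * Complex.exp (-((y : ℂ) * t a)) := by fun_prop
        exact (hc.tendsto 0).comp tendsto_one_div_add_atTop_nhds_zero_nat
    refine tendsto_nhds_unique hlim ?_
    rw [show (fun k : ℕ => ∫ a, v a * Complex.exp (-(((1 / ((k : ℝ) + 1) : ℝ) : ℂ) * t a)) ∂μ) =
      fun _ => 0 from funext fun k => hpos _ (by positivity)]
    exact tendsto_const_nhds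
  · exact hpos x hx

end Laplace

/-! ### Mixed moments and their determination of a function. -/

namespace BergmanBall

variable {n : ℕ}

lemma ae_mem_ball : ∀ᵐ x ∂(ballMeasure n), x ∈ ball (0 : EuclideanSpace ℂ (Fin n)) 1 :=
  Measure.ae_smul_measure (ae_restrict_mem measurableSet_ball) _

lemma ae_ne_zero (hn : 1 ≤ n) : ∀ᵐ x ∂(ballMeasure n), x ≠ 0 := by
  have : Nonempty (Fin n) := ⟨⟨0, hn⟩⟩
  refine Measure.ae_smul_measure (ae_restrict_of_ae ?_) _
  exact Measure.ae_ne _ _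

lemma integrable_mul_continuous {u G : EuclideanSpace ℂ (Fin n) → ℂ}
    (hu : Integrable u (ballMeasure n)) (hG : Continuous G) :
    Integrable (fun z => u z * G z) (ballMeasure n) := by
  obtain ⟨C, hC⟩ := (isCompact_closedBall (0 : EuclideanSpace ℂ (Fin n)) 1).exists_bound_of_continuousOn
    hG.continuousOn
  refine hu.mul_bdd (c := C) hG.aestronglyMeasurable ?_
  filter_upwards [ae_mem_ball] with z hz using hC z (ball_subset_closedBall hz)

lemma memLp_top_continuous {G : EuclideanSpace ℂ (Fin n) → ℂ} (hG : Continuous G) :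
    MemLp G ∞ (ballMeasure n) := by
  obtain ⟨C, hC⟩ := (isCompact_closedBall (0 : EuclideanSpace ℂ (Fin n)) 1).exists_bound_of_continuousOn
    hG.continuousOn
  refine memLp_top_of_bound hG.aestronglyMeasurable C ?_
  filter_upwards [ae_mem_ball] with z hz using hC z (ball_subset_closedBall hz)

/-- An entire function on `ℂⁿ` which is homogeneous of degree `k`. -/
structure IsHomogeneousHolomorphic (k : ℕ) (q : EuclideanSpace ℂ (Fin n) → ℂ) : Prop where
  differentiable : Differentiable ℂ q
  map_smul : ∀ (c : ℂ) (z : EuclideanSpace ℂ (Fin n)), q (c • z) = c ^ k * q z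

namespace IsHomogeneousHolomorphic

variable {k l : ℕ} {q p : EuclideanSpace ℂ (Fin n) → ℂ}

lemma continuous (hq : IsHomogeneousHolomorphic k q) : Continuous q := hq.differentiable.continuous

lemma one : IsHomogeneousHolomorphic 0 (fun _ : EuclideanSpace ℂ (Fin n) => (1 : ℂ)) :=
  ⟨by fun_prop, by simp⟩

lemma coord (i : Fin n) : IsHomogeneousHolomorphic 1 (fun z : EuclideanSpace ℂ (Fin n) => z i) :=
  ⟨by fun_prop, by simp⟩

lemma mul (hq : IsHomogeneousHolomorphic k q) (hp : IsHomogeneousHolomorphic l p) :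
    IsHomogeneousHolomorphic (k + l) (fun z => q z * p z) :=
  ⟨hq.differentiable.mul hp.differentiable, fun c z => by
    rw [hq.map_smul, hp.map_smul]; ring⟩

lemma continuous_mul_star (hq : IsHomogeneousHolomorphic k q)
    (hp : IsHomogeneousHolomorphic l p) : Continuous fun z => q z * star (p z) :=
  hq.continuous.mul hp.continuous.star

end IsHomogeneousHolomorphic

/-- The products of a homogeneous holomorphic function and a conjugate of such a function. -/
def mixedMonomials (n : ℕ) : Submonoid C(EuclideanSpace ℂ (Fin n), ℂ) where
  carrier := {h | ∃ k l q p, IsHomogeneousHolomorphic k q ∧ IsHomogeneousHolomorphic l p ∧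
    ∀ z, h z = q z * star (p z)}
  one_mem' := ⟨0, 0, _, _, .one, .one, by simp⟩
  mul_mem' := by
    rintro h h' ⟨k, l, q, p, hq, hp, e⟩ ⟨k', l', q', p', hq', hp', e'⟩
    refine ⟨_, _, _, _, hq.mul hq', hp.mul hp', fun z => ?_⟩
    rw [ContinuousMap.mul_apply, e, e', star_mul']
    ring

/-- The star algebra generated by the homogeneous holomorphic functions. -/
noncomputable def mixedPolynomials (n : ℕ) : StarSubalgebra ℂ C(EuclideanSpace ℂ (Fin n), ℂ) where
  __ := Algebra.adjoin ℂ (mixedMonomials n : Set C(EuclideanSpace ℂ (Fin n), ℂ))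
  star_mem' := by
    intro h hh
    change h ∈ Algebra.adjoin ℂ _ at hh
    change star h ∈ Algebra.adjoin ℂ _
    induction hh using Algebra.adjoin_induction with
    | mem x hx =>
      obtain ⟨k, l, q, p, hq, hp, e⟩ := hx
      refine Algebra.subset_adjoin ⟨l, k, p, q, hp, hq, fun z => ?_⟩
      rw [ContinuousMap.star_apply, e, star_mul', star_star, mul_comm]
    | algebraMap r =>
      rw [← algebraMap_star_comm]
      exact Subalgebra.algebraMap_mem _ _
    | add x y _ _ hx hy => rw [star_add]; exact add_mem hx hy
    | mul x y _ _ hx hy => rw [star_mul]; exact mul_mem hy hx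

/-- A function all of whose mixed moments vanish is zero. -/
lemma ae_eq_zero_of_moments {u : EuclideanSpace ℂ (Fin n) → ℂ} (hu : Integrable u (ballMeasure n))
    (h : ∀ k l q p, IsHomogeneousHolomorphic k q → IsHomogeneousHolomorphic l p →
      ∫ z, u z * (q z * star (p z)) ∂(ballMeasure n) = 0) :
    u =ᵐ[ballMeasure n] 0 := by
  -- The mixed monomials are closed under multiplication, so the algebra they generate is their
  -- linear span and linearity suffices.
  have hpoly : ∀ P ∈ mixedPolynomials n, ∫ z, u z * P z ∂(ballMeasure n) = 0 := by
    intro P hP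
    change P ∈ Subalgebra.toSubmodule (Algebra.adjoin ℂ _) at hP
    rw [Algebra.adjoin_eq_span, Submonoid.closure_eq] at hP
    induction hP using Submodule.span_induction with
    | mem x hx =>
      obtain ⟨k, l, q, p, hq, hp, e⟩ := hx
      simp only [e]
      exact h k l q p hq hp
    | zero => simp
    | add x y _ _ hx hy =>
      simp only [ContinuousMap.add_apply, mul_add]
      rw [integral_add (integrable_mul_continuous hu x.continuous)
        (integrable_mul_continuous hu y.continuous), hx, hy, add_zero]
    | smul c x _ hx =>
      simp only [ContinuousMap.smul_apply, smul_eq_mul, mul_left_comm _ c]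
      rw [integral_const_mul, hx, mul_zero]
  let K := closedBall (0 : EuclideanSpace ℂ (Fin n)) 1
  have : CompactSpace K := isCompact_iff_compactSpace.1 (isCompact_closedBall _ _)
  let ι : C(K, EuclideanSpace ℂ (Fin n)) := ⟨Subtype.val, continuous_subtype_val⟩
  let A : StarSubalgebra ℂ C(K, ℂ) :=
    (mixedPolynomials n).map (ContinuousMap.compStarAlgHom' ℂ ℂ ι)
  -- Stone–Weierstrass on the closed ball: the coordinate functions already separate points.
  have hA : A.topologicalClosure = ⊤ := by
    apply ContinuousMap.starSubalgebra_topologicalClosure_eq_top_of_separatesPoints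
    intro x y hxy
    have hxy' : ∃ i, (x : EuclideanSpace ℂ (Fin n)) i ≠ (y : EuclideanSpace ℂ (Fin n)) i := by
      by_contra! hc
      exact hxy (Subtype.ext (PiLp.ext hc))
    obtain ⟨i, hi⟩ := hxy'
    let P : C(EuclideanSpace ℂ (Fin n), ℂ) :=
      ⟨fun z => z i, (IsHomogeneousHolomorphic.coord i).continuous⟩
    have hP : P ∈ mixedPolynomials n := by
      refine Algebra.subset_adjoin ⟨1, 0, _, _, .coord i, .one, fun z => ?_⟩
      simp [P]
    refine ⟨_, ⟨ContinuousMap.compStarAlgHom' ℂ ℂ ι P, ⟨P, hP, rfl⟩, rfl⟩, ?_⟩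
    exact hi
  refine ae_eq_zero_of_integral_contDiff_smul_eq_zero hu.locallyIntegrable fun g hg _ => ?_
  have hgc : Continuous fun z => (g z : ℂ) := by
    have := hg.continuous
    fun_prop
  have hcomm : ∫ z, g z • u z ∂(ballMeasure n) = ∫ z, u z * (g z : ℂ) ∂(ballMeasure n) := by
    congr 1; ext z; rw [Complex.real_smul, mul_comm]
  rw [hcomm, ← norm_le_zero_iff]
  refine le_of_forall_pos_le_add fun ε hε => ?_
  set I := ∫ z, ‖u z‖ ∂(ballMeasure n) with hI
  have hI0 : 0 ≤ I := by positivity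
  let G : C(K, ℂ) := ⟨fun z => (g z : ℂ), hgc.comp continuous_subtype_val⟩
  have hG : G ∈ A.topologicalClosure := hA ▸ trivial
  have hG' : G ∈ closure (A : Set C(K, ℂ)) := hG
  -- The error is integrated against `‖u‖`, whose integral is `I`. The `+ 1` covers `I = 0`.
  obtain ⟨_, ⟨P, hP, rfl⟩, hd⟩ := Metric.mem_closure_iff.1 hG' (ε / (I + 1)) (by positivity)
  have h1 : ∫ z, u z * (g z : ℂ) ∂(ballMeasure n) =
      ∫ z, u z * ((g z : ℂ) - P z) ∂(ballMeasure n) := by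
    simp only [mul_sub]
    rw [integral_sub (integrable_mul_continuous hu hgc)
      (integrable_mul_continuous hu P.continuous), hpoly P hP, sub_zero]
  rw [h1, zero_add]
  have h2 : ‖∫ z, u z * ((g z : ℂ) - P z) ∂(ballMeasure n)‖ ≤
      ∫ z, ‖u z‖ * (ε / (I + 1)) ∂(ballMeasure n) := by
    refine norm_integral_le_of_norm_le (hu.norm.mul_const _) ?_
    filter_upwards [ae_mem_ball] with z hz
    rw [norm_mul]
    refine mul_le_mul_of_nonneg_left ?_ (norm_nonneg _)
    have h3 := ContinuousMap.dist_le_iff_of_nonempty.1 hd.le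
      (⟨z, ball_subset_closedBall hz⟩ : K)
    rw [dist_eq_norm] at h3
    exact h3
  refine h2.trans ?_
  rw [integral_mul_const, ← hI, mul_div_assoc', div_le_iff₀ (by positivity)]
  nlinarith

/-- The substitution `t = -2 log ‖z‖` turns the moment of order `d` into a Laplace transform at
`d/2`, so the even order `2m` sits at the natural number `m`. -/
lemma exp_log_norm (d : ℕ) {z : EuclideanSpace ℂ (Fin n)} (hz : z ≠ 0) :
    Complex.exp (-((((d : ℝ) / 2 : ℝ) : ℂ) * ((-2 * Real.log ‖z‖ : ℝ) : ℂ))) =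
      ((‖z‖ ^ d : ℝ) : ℂ) := by
  rw [← Complex.ofReal_mul, ← Complex.ofReal_neg, ← Complex.ofReal_exp]
  congr 1
  rw [show -((d : ℝ) / 2 * (-2 * Real.log ‖z‖)) = d * Real.log ‖z‖ by ring, Real.exp_nat_mul,
    Real.exp_log (norm_pos_iff.2 hz)]

/-- If the even radial moments of a function vanish for a set of orders that is not thin, then
all its radial moments vanish. -/
lemma integral_mul_norm_pow_eq_zero (hn : 1 ≤ n) {v : EuclideanSpace ℂ (Fin n) → ℂ}
    (hv : Integrable v (ballMeasure n)) {S : Set ℕ} (hS : ¬ ThinSet S)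
    (hz : ∀ m ∈ S, ∫ z, v z * ((‖z‖ ^ (2 * m) : ℝ) : ℂ) ∂(ballMeasure n) = 0) (d : ℕ) :
    ∫ z, v z * ((‖z‖ ^ d : ℝ) : ℂ) ∂(ballMeasure n) = 0 := by
  have hrw : ∀ d : ℕ, ∫ z, v z * ((‖z‖ ^ d : ℝ) : ℂ) ∂(ballMeasure n) =
      ∫ z, v z * Complex.exp (-((((d : ℝ) / 2 : ℝ) : ℂ) * ((-2 * Real.log ‖z‖ : ℝ) : ℂ)))
        ∂(ballMeasure n) := by
    intro d
    refine integral_congr_ae ?_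
    filter_upwards [ae_ne_zero hn] with z hz
    rw [exp_log_norm d hz]
  rw [hrw]
  refine laplace_eq_zero_of_not_thin hv (by fun_prop) ?_ hS (fun m hm => ?_) (by positivity)
  · filter_upwards [ae_mem_ball] with z hz
    rw [mem_ball_zero_iff] at hz
    have := Real.log_nonpos (norm_nonneg z) hz.le
    linarith
  · have h := hz m hm
    rw [hrw] at h
    convert h using 6
    push_cast
    ring

/-- A function is zero as soon as its mixed moments of bidegree `(k, l)` vanish for all `k` and `l`
outside a thin set. -/
lemma ae_eq_zero_of_moments_off_thin (hn : 1 ≤ n) {u : EuclideanSpace ℂ (Fin n) → ℂ}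
    (hu : Integrable u (ballMeasure n)) {Z : Set ℕ} (hZ : ThinSet Z)
    (h : ∀ k l q p, k ∉ Z → l ∉ Z → IsHomogeneousHolomorphic k q →
      IsHomogeneousHolomorphic l p → ∫ z, u z * (q z * star (p z)) ∂(ballMeasure n) = 0) :
    u =ᵐ[ballMeasure n] 0 := by
  -- Each factor `‖z‖² = ∑ z_i * star (z_i)` is absorbed by replacing `q` and `p` with `q z_i` and
  -- `p z_i`, which raises both degrees by one.
  have key : ∀ m k l q p, k + m ∉ Z → l + m ∉ Z → IsHomogeneousHolomorphic k q →
      IsHomogeneousHolomorphic l p →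
      ∫ z, u z * (q z * star (p z)) * ((‖z‖ ^ (2 * m) : ℝ) : ℂ) ∂(ballMeasure n) = 0 := by
    intro m
    induction m with
    | zero => intro k l q p hk hl hq hp; simpa using h k l q p hk hl hq hp
    | succ m ih =>
      intro k l q p hk hl hq hp
      have hexp : ∀ z : EuclideanSpace ℂ (Fin n),
          u z * (q z * star (p z)) * ((‖z‖ ^ (2 * (m + 1)) : ℝ) : ℂ) =
          ∑ i, u z * ((q z * z i) * star (p z * z i)) * ((‖z‖ ^ (2 * m) : ℝ) : ℂ) := by
        intro z
        have h1 : ((‖z‖ ^ 2 : ℝ) : ℂ) = ∑ i, z i * star (z i) := by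
          rw [EuclideanSpace.norm_sq_eq, Complex.ofReal_sum]
          refine Finset.sum_congr rfl fun i _ => ?_
          rw [← starRingEnd_apply, Complex.mul_conj, Complex.normSq_eq_norm_sq]
        rw [show (‖z‖ ^ (2 * (m + 1)) : ℝ) = ‖z‖ ^ 2 * ‖z‖ ^ (2 * m) by ring, Complex.ofReal_mul,
          h1, Finset.sum_mul, Finset.mul_sum]
        refine Finset.sum_congr rfl fun i _ => ?_
        rw [star_mul']
        ring
      simp only [hexp]
      rw [integral_finsetSum]
      · refine Finset.sum_eq_zero fun i _ => ?_
        refine ih _ _ _ _ ?_ ?_ (hq.mul (.coord i)) (hp.mul (.coord i))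
        · rwa [add_assoc, add_comm 1 m]
        · rwa [add_assoc, add_comm 1 m]
      · intro i _
        refine integrable_mul_continuous (integrable_mul_continuous hu
          ((hq.mul (.coord i)).continuous_mul_star (hp.mul (.coord i)))) (by fun_prop)
  refine ae_eq_zero_of_moments hu fun k l q p hq hp => ?_
  -- The bad shifts `m` form a union of two translates of `Z`, which is thin, so the good ones do
  -- not form a thin set.
  have hS : ¬ ThinSet ({m | m + k ∈ Z} ∪ {m | m + l ∈ Z})ᶜ :=
    ((hZ.preimage_add k).union (hZ.preimage_add l)).not_compl
  have h0 := integral_mul_norm_pow_eq_zero hn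
    (integrable_mul_continuous hu (hq.continuous_mul_star hp)) hS (fun m hm => by
      rw [Set.mem_compl_iff, Set.mem_union, not_or] at hm
      refine key m k l q p ?_ ?_ hq hp
      · rw [add_comm]; exact hm.1
      · rw [add_comm]; exact hm.2) 0
  simpa using h0

end BergmanBall

/-! ### Integration against radial weights: polar coordinates and rotations. -/

namespace BergmanBall

variable {n : ℕ}

lemma integral_ballMeasure (F : EuclideanSpace ℂ (Fin n) → ℂ) :
    ∫ z, F z ∂(ballMeasure n) =
      (((volume (ball (0 : EuclideanSpace ℂ (Fin n)) 1))⁻¹.toReal : ℝ) : ℂ) *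
        ∫ z in ball 0 1, F z := by
  rw [ballMeasure, integral_smul_measure, Complex.real_smul]

/-- Integration in polar coordinates of the product of a radial function and a homogeneous one. -/
lemma exists_integral_radial_mul (hn : 1 ≤ n) {f : EuclideanSpace ℂ (Fin n) → ℂ} (hf : IsRadial f)
    (d : ℕ) : ∃ J : ℂ, ∀ G : EuclideanSpace ℂ (Fin n) → ℂ,
      (∀ (r : ℝ) (z : EuclideanSpace ℂ (Fin n)), 0 < r → G (r • z) = (r : ℂ) ^ d * G z) →
      ∫ z, f z * G z ∂(ballMeasure n) =
        (∫ ζ, G ζ ∂(volume : Measure (EuclideanSpace ℂ (Fin n))).toSphere) * J := by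
  have : Nonempty (Fin n) := ⟨⟨0, hn⟩⟩
  obtain ⟨h, hh⟩ := hf
  let j : Set.Ioi (0 : ℝ) → ℂ := fun r =>
    (Set.Iio (1 : ℝ)).indicator (fun r : ℝ => h r * (r : ℂ) ^ d) r
  refine ⟨(((volume (ball (0 : EuclideanSpace ℂ (Fin n)) 1))⁻¹.toReal : ℝ) : ℂ) *
    ∫ r, j r ∂(Measure.volumeIoiPow (Module.finrank ℝ (EuclideanSpace ℂ (Fin n)) - 1)),
    fun G hG => ?_⟩
  rw [integral_ballMeasure, mul_left_comm]
  congr 1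
  rw [← integral_indicator measurableSet_ball, ← integral_prod_mul]
  set F : EuclideanSpace ℂ (Fin n) → ℂ := (ball 0 1).indicator fun z => f z * G z with hF
  -- With `x = ‖x‖ • ζ`, homogeneity moves `‖x‖ ^ d` into the radial factor `j`, which also carries
  -- the cutoff at radius one. The Jacobian is part of the measure `volumeIoiPow`.
  have hpolar : ∀ x : ({0}ᶜ : Set (EuclideanSpace ℂ (Fin n))),
      F x = G (homeomorphUnitSphereProd _ x).1 * j (homeomorphUnitSphereProd _ x).2 := by
    rintro ⟨x, hx⟩
    have hx0 : 0 < ‖x‖ := norm_pos_iff.2 hx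
    simp only [homeomorphUnitSphereProd_apply_fst_coe, hF, j]
    simp only [Set.indicator, homeomorphUnitSphereProd_apply_snd_coe, Set.mem_Iio,
      mem_ball_zero_iff]
    split_ifs with h1
    · rw [hh x (mem_ball_zero_iff.2 h1)]
      have h2 := hG ‖x‖ (‖x‖⁻¹ • x) hx0
      rw [smul_smul, mul_inv_cancel₀ hx0.ne', one_smul] at h2
      rw [h2]
      ring
    · simp
  calc ∫ x, F x = ∫ x : ({0}ᶜ : Set (EuclideanSpace ℂ (Fin n))), F x ∂(volume.comap Subtype.val) := by
        rw [integral_subtype_comap (measurableSet_singleton _).compl F,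
          restrict_compl_singleton]
    _ = _ := by
      simp only [hpolar]
      exact (volume : Measure (EuclideanSpace ℂ (Fin n))).measurePreserving_homeomorphUnitSphereProd.integral_comp
        (Homeomorph.measurableEmbedding _) (fun p => G p.1 * j p.2)

/-- For radial `f`, the integral of `f` against a homogeneous function is proportional to a radial
moment of `f`. -/
lemma integral_radial_mul_homogeneous (hn : 1 ≤ n) {f : EuclideanSpace ℂ (Fin n) → ℂ}
    (hf : IsRadial f) {d : ℕ} {G : EuclideanSpace ℂ (Fin n) → ℂ}
    (hG : ∀ (r : ℝ) (z : EuclideanSpace ℂ (Fin n)), 0 < r → G (r • z) = (r : ℂ) ^ d * G z) :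
    (∫ z, f z * G z ∂(ballMeasure n)) * ∫ z, ((‖z‖ ^ d : ℝ) : ℂ) ∂(ballMeasure n) =
      (∫ z, f z * ((‖z‖ ^ d : ℝ) : ℂ) ∂(ballMeasure n)) * ∫ z, G z ∂(ballMeasure n) := by
  obtain ⟨J, hJ⟩ := exists_integral_radial_mul hn hf d
  -- The weight `1` provides a second relation with the same spherical integrals. Cross-multiplying
  -- eliminates them without dividing.
  obtain ⟨I, hI⟩ := exists_integral_radial_mul (n := n) hn (f := fun _ => 1) ⟨fun _ => 1, by simp⟩ d
  have hN : ∀ (r : ℝ) (z : EuclideanSpace ℂ (Fin n)), 0 < r →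
      ((‖r • z‖ ^ d : ℝ) : ℂ) = (r : ℂ) ^ d * ((‖z‖ ^ d : ℝ) : ℂ) := by
    intro r z hr
    rw [norm_smul, Real.norm_of_nonneg hr.le, mul_pow]
    push_cast
    rfl
  have h1 := hI G hG
  have h2 := hI (fun z => ((‖z‖ ^ d : ℝ) : ℂ)) hN
  simp only [one_mul] at h1 h2
  rw [hJ G hG, hJ _ hN, h1, h2]
  ring

lemma integral_norm_pow_ne_zero (hn : 1 ≤ n) (d : ℕ) :
    ∫ z : EuclideanSpace ℂ (Fin n), ((‖z‖ ^ d : ℝ) : ℂ) ∂(ballMeasure n) ≠ 0 := by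
  rw [integral_complex_ofReal, Complex.ofReal_ne_zero]
  refine ne_of_gt ?_
  have hi : Integrable (fun z : EuclideanSpace ℂ (Fin n) => ‖z‖ ^ d) (ballMeasure n) := by
    refine Integrable.of_bound (by fun_prop) 1 ?_
    filter_upwards [ae_mem_ball] with z hz
    rw [mem_ball_zero_iff] at hz
    rw [Real.norm_of_nonneg (by positivity)]
    exact pow_le_one₀ (norm_nonneg _) hz.le
  refine (integral_pos_iff_support_of_nonneg (fun z => by positivity) hi).2 ?_
  have : (Function.support fun z : EuclideanSpace ℂ (Fin n) => ‖z‖ ^ d) ∈ ae (ballMeasure n) := by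
    filter_upwards [ae_ne_zero hn] with z hz
    exact pow_ne_zero _ (norm_ne_zero_iff.2 hz)
  refine pos_iff_ne_zero.2 fun h0 => ?_
  have hfalse : ∀ᵐ _z ∂(ballMeasure n), False := by
    filter_upwards [this, measure_eq_zero_iff_ae_notMem.1 h0] with z h1 h2 using h2 h1
  simpa using hfalse.exists

lemma measurePreserving_rotation {c : ℂ} (hc : ‖c‖ = 1) :
    MeasurePreserving (fun z : EuclideanSpace ℂ (Fin n) => c • z) (ballMeasure n)
      (ballMeasure n) := by
  have hne : c ≠ 0 := by
    rintro rfl; simp at hc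
  let e : EuclideanSpace ℂ (Fin n) ≃ₗᵢ[ℝ] EuclideanSpace ℂ (Fin n) :=
    { (LinearEquiv.smulOfNeZero ℂ (EuclideanSpace ℂ (Fin n)) c hne).restrictScalars ℝ with
      norm_map' := fun w => by
        change ‖c • w‖ = ‖w‖
        rw [norm_smul, hc, one_mul] }
  have h := e.measurePreserving.restrict_preimage
    (measurableSet_ball (x := (0 : EuclideanSpace ℂ (Fin n))) (ε := 1))
  have hp : e ⁻¹' ball 0 1 = ball 0 1 := by
    ext w; simp
  rw [hp] at h
  exact h.smul_measure _

lemma integral_rotation {G : EuclideanSpace ℂ (Fin n) → ℂ} {c : ℂ} (hc : ‖c‖ = 1) :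
    ∫ z, G (c • z) ∂(ballMeasure n) = ∫ z, G z ∂(ballMeasure n) := by
  have hne : c ≠ 0 := by
    rintro rfl; simp at hc
  exact (measurePreserving_rotation hc).integral_comp
    (Homeomorph.smulOfNeZero c hne).measurableEmbedding G

namespace IsHomogeneousHolomorphic

variable {k l : ℕ} {q p : EuclideanSpace ℂ (Fin n) → ℂ}

lemma star_mul_homogeneous (hq : IsHomogeneousHolomorphic k q) (hp : IsHomogeneousHolomorphic l p)
    (r : ℝ) (z : EuclideanSpace ℂ (Fin n)) :
    q (r • z) * star (p (r • z)) = (r : ℂ) ^ (k + l) * (q z * star (p z)) := by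
  have h : r • z = (r : ℂ) • z := rfl
  rw [h, hq.map_smul, hp.map_smul, star_mul', star_pow]
  simp only [RCLike.star_def, Complex.conj_ofReal]
  ring

/-- Homogeneous functions of different degrees are orthogonal with respect to radial weights. -/
lemma integral_radial_eq_zero (hq : IsHomogeneousHolomorphic k q)
    (hp : IsHomogeneousHolomorphic l p) (hkl : k ≠ l) {f : EuclideanSpace ℂ (Fin n) → ℂ}
    (hf : IsRadial f) : ∫ z, f z * (q z * star (p z)) ∂(ballMeasure n) = 0 := by
  obtain ⟨h, hh⟩ := hf
  set X := ∫ z, f z * (q z * star (p z)) ∂(ballMeasure n) with hX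
  have hrot : ∀ c : ℂ, ‖c‖ = 1 → X = c ^ k * star (c ^ l) * X := by
    intro c hc
    rw [hX, ← integral_const_mul, ← integral_rotation hc]
    refine integral_congr_ae ?_
    filter_upwards [ae_mem_ball] with z hz
    have hcz : c • z ∈ ball (0 : EuclideanSpace ℂ (Fin n)) 1 := by
      rw [mem_ball_zero_iff] at hz ⊢
      rwa [norm_smul, hc, one_mul]
    rw [hh z hz, hh _ hcz, norm_smul, hc, one_mul, hq.map_smul, hp.map_smul, star_mul']
    ring
  -- A single rotation, by one radian, suffices: if the integral were nonzero, then `exp(i (k - l))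
  -- = 1`, hence `k - l = 2π m` with `m ≠ 0`, contradicting the irrationality of `π`.
  have h1 := hrot (Complex.exp ((1 : ℝ) * Complex.I)) (Complex.norm_exp_ofReal_mul_I _)
  by_contra hne
  have h2 := mul_right_cancel₀ hne ((one_mul X).trans h1)
  rw [RCLike.star_def, ← Complex.exp_nat_mul, ← Complex.exp_nat_mul, ← Complex.exp_conj,
    ← Complex.exp_add, eq_comm, Complex.exp_eq_one_iff] at h2
  obtain ⟨m, hm⟩ := h2
  have h3 := congrArg Complex.im hm
  simp at h3
  have hm0 : m ≠ 0 := by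
    rintro rfl
    simp at h3
    exact hkl (by exact_mod_cast (by linarith : (k : ℝ) = l))
  refine irrational_pi.ne_rat (((k : ℚ) - l) / (2 * m)) ?_
  have : (m : ℝ) ≠ 0 := by exact_mod_cast hm0
  push_cast
  field_simp
  linarith

end IsHomogeneousHolomorphic

/-! ### Homogeneous expansion and completeness of the homogeneous functions. -/

/-- The homogeneous component of degree `k` of a holomorphic function. -/
noncomputable def homogeneousComponent (F : EuclideanSpace ℂ (Fin n) → ℂ) (k : ℕ)
    (z : EuclideanSpace ℂ (Fin n)) : ℂ :=
  (k.factorial : ℂ)⁻¹ * iteratedDeriv k (fun t : ℂ => F (t • z)) 0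

lemma iteratedDeriv_comp_mul_left' (g : ℂ → ℂ) (c : ℂ) (k : ℕ) :
    iteratedDeriv k (fun t => g (c * t)) = fun t => c ^ k * iteratedDeriv k g (c * t) := by
  induction k with
  | zero => simp
  | succ k ih =>
    ext t
    rw [iteratedDeriv_succ, ih, deriv_const_mul_field, deriv_comp_mul_left, iteratedDeriv_succ,
      smul_eq_mul]
    ring

lemma homogeneousComponent_smul (F : EuclideanSpace ℂ (Fin n) → ℂ) (k : ℕ) (c : ℂ)
    (z : EuclideanSpace ℂ (Fin n)) :
    homogeneousComponent F k (c • z) = c ^ k * homogeneousComponent F k z := by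
  have h : (fun t : ℂ => F (t • c • z)) = fun t => (fun s : ℂ => F (s • z)) (c * t) := by
    ext t
    rw [smul_smul, mul_comm]
  rw [homogeneousComponent, h, iteratedDeriv_comp_mul_left' (fun s : ℂ => F (s • z)), homogeneousComponent]
  simp only [mul_zero]
  ring

lemma differentiableOn_slice {F : EuclideanSpace ℂ (Fin n) → ℂ} (hF : DifferentiableOn ℂ F (ball 0 1))
    {z : EuclideanSpace ℂ (Fin n)} {R : ℝ} (hz : R * ‖z‖ ≤ 1) (hz1 : ‖z‖ ≠ 0) :
    DifferentiableOn ℂ (fun t : ℂ => F (t • z)) (ball 0 R) := by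
  refine hF.comp (by fun_prop) fun t ht => ?_
  rw [mem_ball_zero_iff] at ht ⊢
  rw [norm_smul]
  exact (mul_lt_mul_of_pos_right ht (by positivity)).trans_le hz

/-- Cauchy's formula for the Taylor coefficients of the slice `t ↦ F (t • z)` on the unit circle. -/
lemma homogeneousComponent_eq_integral {F : EuclideanSpace ℂ (Fin n) → ℂ}
    (hF : DifferentiableOn ℂ F (ball 0 1)) (k : ℕ) {z : EuclideanSpace ℂ (Fin n)}
    (hz : z ∈ ball 0 1) :
    ∫ θ in (0 : ℝ)..2 * Real.pi, Complex.exp (-(k * (θ * Complex.I))) *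
      F (Complex.exp (θ * Complex.I) • z) = 2 * Real.pi * homogeneousComponent F k z := by
  have hd : DifferentiableOn ℂ (fun t : ℂ => F (t • z)) (closedBall 0 1) := by
    refine hF.comp (by fun_prop) fun t ht => ?_
    rw [mem_closedBall_zero_iff] at ht
    rw [mem_ball_zero_iff] at hz ⊢
    rw [norm_smul]
    nlinarith [norm_nonneg z, norm_nonneg t]
  have h := hd.circleIntegral_one_div_sub_center_pow_smul one_pos k
  simp only [circleIntegral, deriv_circleMap, sub_zero, circleMap_zero, Complex.ofReal_one,
    one_mul, smul_eq_mul] at h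
  have hI : (Complex.I : ℂ) ≠ 0 := Complex.I_ne_zero
  refine mul_left_cancel₀ hI ?_
  rw [← intervalIntegral.integral_const_mul]
  calc _ = _ := by
        refine intervalIntegral.integral_congr fun θ _ => ?_
        rw [Complex.exp_neg, Complex.exp_nat_mul]
        have := Complex.exp_ne_zero (θ * Complex.I)
        field_simp
        ring
    _ = _ := h
    _ = _ := by
      rw [homogeneousComponent]
      ring

/-- Near the origin, the Cauchy integral is differentiated under the integral sign, with the
derivative bound `C` as dominating constant. Homogeneity then carries differentiability from the
small ball to all of `ℂⁿ`. -/
lemma isHomogeneousHolomorphic_homogeneousComponent {F : EuclideanSpace ℂ (Fin n) → ℂ}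
    (hF : DifferentiableOn ℂ F (ball 0 1)) {r C : ℝ} (hr : 0 < r)
    (hs : ball (0 : EuclideanSpace ℂ (Fin n)) r ⊆ ball 0 1)
    (hC : ∀ x ∈ ball (0 : EuclideanSpace ℂ (Fin n)) r, ‖fderiv ℂ F x‖ ≤ C) (k : ℕ) :
    IsHomogeneousHolomorphic k (homogeneousComponent F k) := by
  have hrot : ∀ (θ : ℝ) (ρ : ℝ) (x : EuclideanSpace ℂ (Fin n)), x ∈ ball 0 ρ →
      Complex.exp (θ * Complex.I) • x ∈ ball (0 : EuclideanSpace ℂ (Fin n)) ρ := by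
    intro θ ρ x hx
    rw [mem_ball_zero_iff] at hx ⊢
    rwa [norm_smul, Complex.norm_exp_ofReal_mul_I, one_mul]
  have hcont : ∀ x ∈ ball (0 : EuclideanSpace ℂ (Fin n)) r, Continuous fun θ : ℝ =>
      Complex.exp (-(k * (θ * Complex.I))) * F (Complex.exp (θ * Complex.I) • x) := by
    intro x hx
    refine Continuous.mul (by fun_prop) ?_
    refine hF.continuousOn.comp_continuous (by fun_prop) fun θ => hs (hrot θ r x hx)
  have hball : ∀ x ∈ ball (0 : EuclideanSpace ℂ (Fin n)) r,
      DifferentiableAt ℂ (homogeneousComponent F k) x := by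
    intro x hx
    have hU : ball (0 : EuclideanSpace ℂ (Fin n)) r ∈ 𝓝 x := isOpen_ball.mem_nhds hx
    have hmain : HasFDerivAt (𝕜 := ℂ) (fun x : EuclideanSpace ℂ (Fin n) =>
        ∫ θ in (0 : ℝ)..2 * Real.pi, Complex.exp (-(k * (θ * Complex.I))) *
          F (Complex.exp (θ * Complex.I) • x))
        (∫ θ in (0 : ℝ)..2 * Real.pi, Complex.exp (-(k * (θ * Complex.I))) •
          (Complex.exp (θ * Complex.I) • fderiv ℂ F (Complex.exp (θ * Complex.I) • x))) x := by
      refine intervalIntegral.hasFDerivAt_integral_of_dominated_of_fderiv_le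
        (F' := fun (y : EuclideanSpace ℂ (Fin n)) (θ : ℝ) => Complex.exp (-(k * (θ * Complex.I))) •
          (Complex.exp (θ * Complex.I) • fderiv ℂ F (Complex.exp (θ * Complex.I) • y)))
        (bound := fun _ => C) hU ?_ ?_ ?_ ?_ ?_ ?_
      · filter_upwards [hU] with y hy using (hcont y hy).aestronglyMeasurable
      · exact (hcont x hx).intervalIntegrable _ _
      · have h1 : Measurable fun θ : ℝ => fderiv ℂ F (Complex.exp (θ * Complex.I) • x) :=
          (measurable_fderiv ℂ F).comp (by fun_prop)
        have h2 : Continuous fun θ : ℝ => Complex.exp (-(k * (θ * Complex.I))) := by fun_prop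
        have h3 : Continuous fun θ : ℝ => Complex.exp (θ * Complex.I) := by fun_prop
        refine h2.aestronglyMeasurable.smul (h3.aestronglyMeasurable.smul ?_)
        exact h1.aestronglyMeasurable
      · refine ae_of_all _ fun θ _ y hy => ?_
        rw [norm_smul, norm_smul, Complex.norm_exp_ofReal_mul_I, one_mul,
          show -((k : ℂ) * (θ * Complex.I)) = ((-(k * θ) : ℝ) : ℂ) * Complex.I by push_cast; ring,
          Complex.norm_exp_ofReal_mul_I, one_mul]
        exact hC _ (hrot θ r y hy)
      · exact intervalIntegrable_const
      · refine ae_of_all _ fun θ _ y hy => ?_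
        have h1 := (hF _ (hs (hrot θ r y hy))).differentiableAt
          (isOpen_ball.mem_nhds (hs (hrot θ r y hy)))
        have h2 : HasFDerivAt (fun y : EuclideanSpace ℂ (Fin n) => Complex.exp (θ * Complex.I) • y)
            (Complex.exp (θ * Complex.I) • ContinuousLinearMap.id ℂ (EuclideanSpace ℂ (Fin n))) y :=
          (hasFDerivAt_id y).fun_const_smul _
        have h3 := (h1.hasFDerivAt.comp y h2).const_mul (Complex.exp (-(k * (θ * Complex.I))))
        refine h3.congr_fderiv ?_
        ext v
        simp
    have hev : homogeneousComponent F k =ᶠ[𝓝 x] fun y => (2 * Real.pi : ℂ)⁻¹ *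
        ∫ θ in (0 : ℝ)..2 * Real.pi, Complex.exp (-(k * (θ * Complex.I))) *
          F (Complex.exp (θ * Complex.I) • y) := by
      filter_upwards [hU] with y hy
      rw [homogeneousComponent_eq_integral hF k (hs hy), inv_mul_cancel_left₀]
      exact_mod_cast Real.two_pi_pos.ne'
    exact (hmain.differentiableAt.const_mul _).congr_of_eventuallyEq hev
  refine ⟨fun z => ?_, homogeneousComponent_smul F k⟩
  set c : ℂ := ((r / (2 * (‖z‖ + 1)) : ℝ) : ℂ) with hc
  have hc0 : c ≠ 0 := by
    rw [hc, Complex.ofReal_ne_zero]; positivity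
  have hcz : c • z ∈ ball (0 : EuclideanSpace ℂ (Fin n)) r := by
    rw [mem_ball_zero_iff, norm_smul, hc, Complex.norm_real, Real.norm_of_nonneg (by positivity),
      div_mul_eq_mul_div, div_lt_iff₀ (by positivity)]
    nlinarith [norm_nonneg z]
  have heq : homogeneousComponent F k = fun w => (c ^ k)⁻¹ * homogeneousComponent F k (c • w) := by
    ext w
    rw [homogeneousComponent_smul, inv_mul_cancel_left₀ (pow_ne_zero _ hc0)]
  rw [heq]
  refine DifferentiableAt.const_mul ?_ _
  exact (hball _ hcz).comp z (by fun_prop)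

/-- The slice through `z` is holomorphic on a disc of radius `1/‖z‖ > 1`, so its Taylor series at `t
= 1` sums to `F z`. -/
lemma eq_zero_of_homogeneousComponent_eq_zero {F : EuclideanSpace ℂ (Fin n) → ℂ}
    (hF : DifferentiableOn ℂ F (ball 0 1)) {z : EuclideanSpace ℂ (Fin n)} (hz : z ∈ ball 0 1)
    (hz0 : z ≠ 0) (h : ∀ k, homogeneousComponent F k z = 0) : F z = 0 := by
  rw [mem_ball_zero_iff] at hz
  have hz1 : 0 < ‖z‖ := norm_pos_iff.2 hz0
  have hd := differentiableOn_slice hF (R := ‖z‖⁻¹) (inv_mul_cancel₀ hz1.ne').le hz1.ne'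
  have h1 : (1 : ℂ) ∈ ball (0 : ℂ) ‖z‖⁻¹ := by
    rw [mem_ball_zero_iff, norm_one]
    exact (one_lt_inv₀ hz1).2 hz
  have hs := Complex.hasSum_taylorSeries_on_ball hd h1
  simp only [one_smul, sub_zero, one_pow, smul_eq_mul, one_mul] at hs
  rw [show (fun k : ℕ => (k.factorial : ℂ)⁻¹ * iteratedDeriv k (fun t : ℂ => F (t • z)) 0) =
    fun _ => 0 from funext h] at hs
  exact hs.unique hasSum_zero

/-- A function in the Bergman space which is orthogonal to all homogeneous holomorphic functions
is zero. -/
lemma ae_eq_zero_of_orthogonal_homogeneous (hn : 1 ≤ n) (φ : bergmanSpace n)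
    (h : ∀ k q, IsHomogeneousHolomorphic k q →
      ∫ z, star (q z) * (φ : Lp ℂ 2 (ballMeasure n)) z ∂(ballMeasure n) = 0) : φ = 0 := by
  obtain ⟨F₀, hF₀, hφ₀⟩ := φ.2
  -- Cutting off outside the ball makes the representative measurable everywhere, as needed to use
  -- it on the product space in Fubini's theorem.
  set F : EuclideanSpace ℂ (Fin n) → ℂ := (ball 0 1).indicator F₀ with hFdef
  have hF : DifferentiableOn ℂ F (ball 0 1) :=
    hF₀.congr fun z hz => Set.indicator_of_mem hz _
  have hFm : Measurable F := by
    classical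
    have := ContinuousOn.measurable_piecewise (g := fun _ => (0 : ℂ)) hF₀.continuousOn
      continuousOn_const (measurableSet_ball (x := (0 : EuclideanSpace ℂ (Fin n))) (ε := 1))
    rw [hFdef, ← Set.piecewise_eq_indicator]
    exact this
  have hφ : (φ : Lp ℂ 2 (ballMeasure n)) =ᵐ[ballMeasure n] F := by
    filter_upwards [hφ₀, ae_mem_ball] with z h1 h2
    rw [h1, hFdef, Set.indicator_of_mem h2]
  have hFi : Integrable F (ballMeasure n) :=
    ((memLp_congr_ae hφ).1 (Lp.memLp _)).integrable (by norm_num)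
  obtain ⟨C, r, hr, hs, hb⟩ := exists_local_bound (n := n) (mem_ball_self one_pos)
  have hcomp := fun k => isHomogeneousHolomorphic_homogeneousComponent hF hr hs
    (fun x hx => (hb F φ hF hφ x hx).2) k
  have hzero : ∀ k, ∀ᵐ z ∂(ballMeasure n), homogeneousComponent F k z = 0 := by
    intro k
    set q := homogeneousComponent F k with hq
    have hqc : Continuous q := (hcomp k).continuous
    have horth : ∫ z, star (q z) * F z ∂(ballMeasure n) = 0 := by
      rw [← h k q (hcomp k)]
      refine integral_congr_ae ?_
      filter_upwards [hφ] with z hz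
      rw [hz]
    have hi : Integrable (fun z => star (q z) * F z) (ballMeasure n) := by
      have := integrable_mul_continuous hFi hqc.star
      simpa only [mul_comm] using this
    -- `H` is integrated in both orders. For fixed `θ` it is a rotation of `star q * F`, whose
    -- integral is zero by orthogonality. For fixed `z` the `θ`-integral is `2π ‖q z‖²`. Hence `∫
    -- ‖q‖² = 0`.
    let H : ℝ → EuclideanSpace ℂ (Fin n) → ℂ := fun θ z => star (q z) *
      (Complex.exp (-(k * (θ * Complex.I))) * F (Complex.exp (θ * Complex.I) • z))
    have hHrot : ∀ θ z, H θ z =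
        star (q (Complex.exp (θ * Complex.I) • z)) * F (Complex.exp (θ * Complex.I) • z) := by
      intro θ z
      have h1 : star (Complex.exp (θ * Complex.I) ^ k) = Complex.exp (-(k * (θ * Complex.I))) := by
        rw [RCLike.star_def, ← Complex.exp_nat_mul, ← Complex.exp_conj]
        simp
      have h2 : q (Complex.exp (θ * Complex.I) • z) = Complex.exp (θ * Complex.I) ^ k * q z :=
        (hcomp k).map_smul _ _
      simp only [H]
      rw [h2, star_mul', h1]
      ring
    have hH0 : ∀ θ : ℝ, ∫ z, H θ z ∂(ballMeasure n) = 0 := by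
      intro θ
      simp only [hHrot]
      rw [integral_rotation (G := fun z => star (q z) * F z) (Complex.norm_exp_ofReal_mul_I θ),
        horth]
    have hHi : Integrable (Function.uncurry H)
        ((volume.restrict (Set.uIoc 0 (2 * Real.pi))).prod (ballMeasure n)) := by
      refine (integrable_prod_iff ?_).2 ⟨ae_of_all _ fun θ => ?_, ?_⟩
      · have h1 : Measurable fun x : ℝ × EuclideanSpace ℂ (Fin n) =>
            F (Complex.exp (x.1 * Complex.I) • x.2) := hFm.comp (by fun_prop)
        have h2 : Continuous fun x : ℝ × EuclideanSpace ℂ (Fin n) => star (q x.2) :=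
          (hqc.comp continuous_snd).star
        refine Measurable.aestronglyMeasurable ?_
        exact h2.measurable.mul (Measurable.mul (by fun_prop) h1)
      · simp only [Function.uncurry_apply_pair, hHrot]
        exact (measurePreserving_rotation (Complex.norm_exp_ofReal_mul_I θ)).integrable_comp_of_integrable
          hi
      · have h1 : ∀ θ : ℝ, ∫ z, ‖H θ z‖ ∂(ballMeasure n) =
            ∫ z, ‖star (q z) * F z‖ ∂(ballMeasure n) := by
          intro θ
          simp only [hHrot]
          exact (measurePreserving_rotation (Complex.norm_exp_ofReal_mul_I θ)).integral_comp
            (Homeomorph.smulOfNeZero _ (Complex.exp_ne_zero _)).measurableEmbedding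
            (fun z => ‖star (q z) * F z‖)
        simp only [Function.uncurry_apply_pair, h1]
        exact intervalIntegrable_const.def'
    have hswap := intervalIntegral_integral_swap hHi
    simp only [hH0, intervalIntegral.integral_zero] at hswap
    have hae : ∀ᵐ z ∂(ballMeasure n), ∫ θ in (0 : ℝ)..2 * Real.pi, H θ z =
        ((2 * Real.pi * ‖q z‖ ^ 2 : ℝ) : ℂ) := by
      filter_upwards [ae_mem_ball] with z hz
      simp only [H]
      rw [intervalIntegral.integral_const_mul, homogeneousComponent_eq_integral hF k hz, ← hq,
        RCLike.star_def, mul_left_comm, ← Complex.normSq_eq_conj_mul_self,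
        Complex.normSq_eq_norm_sq]
      push_cast
      ring
    rw [integral_congr_ae hae, integral_complex_ofReal, eq_comm, Complex.ofReal_eq_zero,
      integral_eq_zero_iff_of_nonneg (fun z => by positivity)] at hswap
    · filter_upwards [hswap] with z hz
      have hpi := Real.pi_pos
      simpa [hpi.ne'] using hz
    · refine Integrable.const_mul ?_ _
      have h2 : Continuous fun z => ((‖q z‖ ^ 2 : ℝ) : ℂ) := by fun_prop
      have h3 := integrable_mul_continuous (integrable_const (1 : ℂ)) h2 (n := n)
      simp only [one_mul] at h3
      exact h3.re
  have hF0 : F =ᵐ[ballMeasure n] 0 := by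
    filter_upwards [ae_all_iff.2 hzero, ae_mem_ball, ae_ne_zero hn] with z h1 h2 h3
    exact eq_zero_of_homogeneousComponent_eq_zero hF h2 h3 h1
  refine Subtype.ext ?_
  exact (Lp.eq_zero_iff_ae_eq_zero).2 (hφ.trans hF0)

end BergmanBall

/-! ### Radial Toeplitz operators as diagonal operators. -/

namespace BergmanBall

variable {n : ℕ}

/-- The orders of the vanishing radial moments of a nonzero radial function form a thin set. -/
lemma thinSet_radial_moments_eq_zero (hn : 1 ≤ n) {f : EuclideanSpace ℂ (Fin n) → ℂ}
    (hf : IsRadial f) (hfi : Integrable f (ballMeasure n)) (hf0 : ¬ f =ᵐ[ballMeasure n] 0) :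
    ThinSet {m | ∫ z, f z * ((‖z‖ ^ (2 * m) : ℝ) : ℂ) ∂(ballMeasure n) = 0} := by
  by_contra hS
  have h := integral_mul_norm_pow_eq_zero hn hfi hS (fun m hm => hm)
  refine hf0 (ae_eq_zero_of_moments hfi fun k l q p hq hp => ?_)
  -- For radial `f`, each mixed moment is proportional to a radial moment, and all radial moments
  -- vanish.
  have h1 := integral_radial_mul_homogeneous hn hf (d := k + l)
    (G := fun z => q z * star (p z)) fun r z _ => hq.star_mul_homogeneous hp r z
  rw [h (k + l), zero_mul] at h1
  exact (mul_eq_zero.1 h1).resolve_right (integral_norm_pow_ne_zero hn _)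

lemma bergmanSpace_inner_smul_right (φ ψ : bergmanSpace n) (c : ℂ) :
    inner ℂ φ (c • ψ) = c * inner ℂ φ ψ :=
  inner_smul_right (𝕜 := ℂ) (φ : Lp ℂ 2 (ballMeasure n)) ψ c

lemma bergmanSpace_inner_smul_left (φ ψ : bergmanSpace n) (c : ℂ) :
    inner ℂ (c • φ) ψ = star c * inner ℂ φ ψ :=
  inner_smul_left (𝕜 := ℂ) (φ : Lp ℂ 2 (ballMeasure n)) ψ c

lemma bergmanSpace_inner_conj_symm (φ ψ : bergmanSpace n) :
    (starRingEnd ℂ) (inner ℂ ψ φ) = inner ℂ φ ψ :=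
  inner_conj_symm (𝕜 := ℂ) (φ : Lp ℂ 2 (ballMeasure n)) ψ

lemma inner_eq_integral (φ ψ : Lp ℂ 2 (ballMeasure n)) :
    inner ℂ φ ψ = ∫ z, star (φ z) * ψ z ∂(ballMeasure n) := by
  rw [L2.inner_def]
  congr 1
  ext z
  rw [RCLike.inner_apply, mul_comm, RCLike.star_def]

/-- A homogeneous holomorphic function as an element of the Bergman space. -/
noncomputable def IsHomogeneousHolomorphic.toBergman {k : ℕ} {q : EuclideanSpace ℂ (Fin n) → ℂ}
    (hq : IsHomogeneousHolomorphic k q) : bergmanSpace n :=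
  ⟨((memLp_top_continuous hq.continuous).mono_exponent le_top).toLp q, q,
    hq.differentiable.differentiableOn, MemLp.coeFn_toLp _⟩

namespace IsHomogeneousHolomorphic

variable {k l : ℕ} {q p : EuclideanSpace ℂ (Fin n) → ℂ}

lemma coeFn_toBergman (hq : IsHomogeneousHolomorphic k q) :
    (hq.toBergman : Lp ℂ 2 (ballMeasure n)) =ᵐ[ballMeasure n] q :=
  MemLp.coeFn_toLp ((memLp_top_continuous hq.continuous).mono_exponent le_top)

lemma toBergman_mem_boundedHolomorphic (hq : IsHomogeneousHolomorphic k q) :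
    hq.toBergman ∈ boundedHolomorphic n := by
  obtain ⟨C, hC⟩ := (isCompact_closedBall (0 : EuclideanSpace ℂ (Fin n)) 1).exists_bound_of_continuousOn
    hq.continuous.continuousOn
  exact ⟨q, hq.differentiable.differentiableOn, ⟨C, fun z hz => hC z (ball_subset_closedBall hz)⟩,
    hq.coeFn_toBergman⟩

lemma inner_toBergman_left (hq : IsHomogeneousHolomorphic k q) (φ : Lp ℂ 2 (ballMeasure n))
    {G : EuclideanSpace ℂ (Fin n) → ℂ} (hφ : φ =ᵐ[ballMeasure n] G) :
    inner ℂ (hq.toBergman : Lp ℂ 2 (ballMeasure n)) φ =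
      ∫ z, star (q z) * G z ∂(ballMeasure n) := by
  rw [inner_eq_integral]
  refine integral_congr_ae ?_
  filter_upwards [hq.coeFn_toBergman, hφ] with z h1 h2
  rw [h1, h2]

lemma inner_toBergman_toBergman (hq : IsHomogeneousHolomorphic k q)
    (hp : IsHomogeneousHolomorphic l p) :
    inner ℂ hp.toBergman hq.toBergman = ∫ z, q z * star (p z) ∂(ballMeasure n) := by
  rw [Submodule.coe_inner, hp.inner_toBergman_left _ hq.coeFn_toBergman]
  simp only [mul_comm]

lemma inner_toBergman_eq_zero (hq : IsHomogeneousHolomorphic k q)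
    (hp : IsHomogeneousHolomorphic l p) (hkl : k ≠ l) :
    inner ℂ hp.toBergman hq.toBergman = 0 := by
  rw [hq.inner_toBergman_toBergman hp]
  simpa using hq.integral_radial_eq_zero hp hkl (f := fun _ => 1) ⟨fun _ => 1, by simp⟩

end IsHomogeneousHolomorphic

lemma eq_of_inner_toBergman_eq (hn : 1 ≤ n) {φ ψ : bergmanSpace n}
    (h : ∀ k q (hq : IsHomogeneousHolomorphic k q),
      inner ℂ hq.toBergman φ = inner ℂ hq.toBergman ψ) : φ = ψ := by
  rw [← sub_eq_zero]
  refine ae_eq_zero_of_orthogonal_homogeneous hn _ fun k q hq => ?_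
  rw [← hq.inner_toBergman_left _ EventuallyEq.rfl, ← Submodule.coe_inner, inner_sub_right,
    h k q hq, sub_self]

/-- The elements of the Bergman space given by homogeneous functions. -/
def homogeneousElements (n : ℕ) : Set (bergmanSpace n) :=
  {φ | ∃ k q, ∃ hq : IsHomogeneousHolomorphic k q, φ = hq.toBergman}

/-- An element orthogonal to `D` is orthogonal to every homogeneous function, hence zero. -/
lemma dense_of_homogeneousElements_subset (hn : 1 ≤ n) {D : Submodule ℂ (bergmanSpace n)}
    (h : homogeneousElements n ⊆ D) : Dense (D : Set (bergmanSpace n)) := by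
  rw [Submodule.dense_iff_topologicalClosure_eq_top, Submodule.topologicalClosure_eq_top_iff,
    Submodule.eq_bot_iff]
  intro φ hφ
  refine eq_of_inner_toBergman_eq hn fun k q hq => ?_
  rw [inner_zero_right]
  exact (Submodule.mem_orthogonal _ _).1 hφ _ (h ⟨k, q, hq, rfl⟩)

/-- The projection disappears because `φ` already lies in the Bergman space. -/
lemma inner_toeplitzBounded (φ ψ : bergmanSpace n) {f : EuclideanSpace ℂ (Fin n) → ℂ}
    (hf : MemLp f ∞ (ballMeasure n)) :
    inner ℂ φ (toeplitzBounded f hf ψ) = ∫ z, star ((φ : Lp ℂ 2 (ballMeasure n)) z) *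
      (f z * (ψ : Lp ℂ 2 (ballMeasure n)) z) ∂(ballMeasure n) := by
  have h : inner ℂ φ (toeplitzBounded f hf ψ) =
      inner ℂ (φ : Lp ℂ 2 (ballMeasure n)) ((memLp_mul_of_bounded hf ψ).toLp _) :=
    Submodule.inner_orthogonalProjectionOnto_eq_of_mem_left _ _
  rw [h, inner_eq_integral]
  refine integral_congr_ae ?_
  filter_upwards [(memLp_mul_of_bounded hf ψ).coeFn_toLp] with z hz
  rw [hz]

lemma inner_toBergman_toeplitz {u : EuclideanSpace ℂ (Fin n) → ℂ} (hu : MemLp u 2 (ballMeasure n))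
    {k l : ℕ} {q p : EuclideanSpace ℂ (Fin n) → ℂ} (hq : IsHomogeneousHolomorphic k q)
    (hp : IsHomogeneousHolomorphic l p) :
    inner ℂ hp.toBergman (toeplitz u hu ⟨hq.toBergman, hq.toBergman_mem_boundedHolomorphic⟩) =
      ∫ z, u z * (q z * star (p z)) ∂(ballMeasure n) := by
  have hm := memLp_mul_of_boundedHolomorphic hu hq.toBergman_mem_boundedHolomorphic
  have h : inner ℂ hp.toBergman
      (toeplitz u hu ⟨hq.toBergman, hq.toBergman_mem_boundedHolomorphic⟩) =
      inner ℂ (hp.toBergman : Lp ℂ 2 (ballMeasure n)) (hm.toLp _) :=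
    Submodule.inner_orthogonalProjectionOnto_eq_of_mem_left _ _
  rw [h, hp.inner_toBergman_left _ hm.coeFn_toLp]
  refine integral_congr_ae ?_
  filter_upwards [hq.coeFn_toBergman] with z hz
  rw [hz]
  ring

/-- An operator on the Bergman space which is diagonal with respect to the decomposition into
homogeneous functions, with an eigenvalue that vanishes only on a thin set of degrees. -/
def IsThinDiagonal (A : Module.End ℂ (bergmanSpace n)) : Prop :=
  ∃ a : ℕ → ℂ, ThinSet {k | a k = 0} ∧
    ∀ k q, ∀ hq : IsHomogeneousHolomorphic k q, ∀ φ,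
      inner ℂ hq.toBergman (A φ) = a k * inner ℂ hq.toBergman φ

lemma apply_toBergman_eq_smul (hn : 1 ≤ n) {A : Module.End ℂ (bergmanSpace n)} {a : ℕ → ℂ}
    (hA : ∀ k q, ∀ hq : IsHomogeneousHolomorphic k q, ∀ φ,
      inner ℂ hq.toBergman (A φ) = a k * inner ℂ hq.toBergman φ)
    {k : ℕ} {q : EuclideanSpace ℂ (Fin n) → ℂ} (hq : IsHomogeneousHolomorphic k q) :
    A hq.toBergman = a k • hq.toBergman := by
  refine eq_of_inner_toBergman_eq hn fun l p hp => ?_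
  rw [hA, bergmanSpace_inner_smul_right]
  rcases eq_or_ne k l with rfl | hkl
  · rfl
  · rw [hq.inner_toBergman_eq_zero hp hkl, mul_zero, mul_zero]

namespace IsThinDiagonal

lemma one : IsThinDiagonal (1 : Module.End ℂ (bergmanSpace n)) :=
  ⟨fun _ => 1, by simpa using ThinSet.of_finite Set.finite_empty, fun k q hq φ => by simp⟩

lemma mul {A B : Module.End ℂ (bergmanSpace n)} (hA : IsThinDiagonal A) (hB : IsThinDiagonal B) :
    IsThinDiagonal (A * B) := by
  obtain ⟨a, ha, hA⟩ := hA
  obtain ⟨b, hb, hB⟩ := hB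
  refine ⟨fun k => a k * b k, (ha.union hb).mono fun k hk => mul_eq_zero.1 hk,
    fun k q hq φ => ?_⟩
  rw [Module.End.mul_apply, hA, hB, mul_assoc]

lemma list_prod {L : List (Module.End ℂ (bergmanSpace n))} (hL : ∀ A ∈ L, IsThinDiagonal A) :
    IsThinDiagonal L.prod := by
  induction L with
  | nil => exact one
  | cons A L ih =>
    rw [List.prod_cons]
    exact (hL A List.mem_cons_self).mul (ih fun B hB => hL B (List.mem_cons_of_mem _ hB))

end IsThinDiagonal

/-- The Toeplitz operator of a radial function acts on homogeneous functions of a given degree as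
multiplication by a constant. -/
lemma toeplitzBounded_toBergman (hn : 1 ≤ n) {f : EuclideanSpace ℂ (Fin n) → ℂ}
    (hf : MemLp f ∞ (ballMeasure n)) (hr : IsRadial f) {k : ℕ}
    {q : EuclideanSpace ℂ (Fin n) → ℂ} (hq : IsHomogeneousHolomorphic k q) :
    toeplitzBounded f hf hq.toBergman =
      ((∫ z, f z * ((‖z‖ ^ (2 * k) : ℝ) : ℂ) ∂(ballMeasure n)) /
        ∫ z : EuclideanSpace ℂ (Fin n), ((‖z‖ ^ (2 * k) : ℝ) : ℂ) ∂(ballMeasure n)) •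
          hq.toBergman := by
  refine eq_of_inner_toBergman_eq hn fun l p hp => ?_
  have h1 : inner ℂ hp.toBergman (toeplitzBounded f hf hq.toBergman) =
      ∫ z, f z * (q z * star (p z)) ∂(ballMeasure n) := by
    rw [inner_toeplitzBounded]
    refine integral_congr_ae ?_
    filter_upwards [hq.coeFn_toBergman, hp.coeFn_toBergman] with z h1 h2
    rw [h1, h2]
    ring
  rw [h1, bergmanSpace_inner_smul_right]
  rcases eq_or_ne k l with rfl | hkl
  · have h2 := integral_radial_mul_homogeneous hn hr (d := k + k)
      (G := fun z => q z * star (p z)) fun r z _ => hq.star_mul_homogeneous hp r z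
    rw [hq.inner_toBergman_toBergman hp, div_mul_eq_mul_div,
      eq_div_iff (integral_norm_pow_ne_zero hn _), two_mul, h2]
  · rw [hq.inner_toBergman_eq_zero hp hkl, mul_zero, hq.integral_radial_eq_zero hp hkl hr]

/-- `IsThinDiagonal` asks for the pairing of a homogeneous function with `T_f φ` for every `φ`. The
adjoint of `T_f` is the Toeplitz operator of `star f`, again radial, which acts on the homogeneous
function as a scalar. The eigenvalue is the conjugate of that scalar. -/
lemma isThinDiagonal_toeplitzBounded (hn : 1 ≤ n) {f : EuclideanSpace ℂ (Fin n) → ℂ}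
    (hf : MemLp f ∞ (ballMeasure n)) (hr : IsRadial f) (hf0 : ¬ f =ᵐ[ballMeasure n] 0) :
    IsThinDiagonal (toeplitzBounded f hf) := by
  have hs : MemLp (fun z => star (f z)) ∞ (ballMeasure n) := hf.star
  have hsr : IsRadial fun z => star (f z) := by
    obtain ⟨h, hh⟩ := hr
    exact ⟨fun r => star (h r), fun z hz => congrArg star (hh z hz)⟩
  have hs0 : ¬ (fun z => star (f z)) =ᵐ[ballMeasure n] 0 := by
    intro h
    refine hf0 ?_
    filter_upwards [h] with z hz
    simpa using hz
  refine ⟨fun k => star ((∫ z, star (f z) * ((‖z‖ ^ (2 * k) : ℝ) : ℂ) ∂(ballMeasure n)) /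
        ∫ z : EuclideanSpace ℂ (Fin n), ((‖z‖ ^ (2 * k) : ℝ) : ℂ) ∂(ballMeasure n)), ?_,
    fun k q hq φ => ?_⟩
  · refine (thinSet_radial_moments_eq_zero hn hsr (hs.integrable le_top) hs0).mono fun k hk => ?_
    exact (div_eq_zero_iff.1 (star_eq_zero.1 hk)).resolve_right (integral_norm_pow_ne_zero hn _)
  · rw [← bergmanSpace_inner_smul_left, ← toeplitzBounded_toBergman hn hs hsr hq,
      ← bergmanSpace_inner_conj_symm _ φ, inner_toeplitzBounded, inner_toeplitzBounded, ← integral_conj]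
    congr 1
    ext z
    simp only [RCLike.star_def, map_mul, Complex.conj_conj]
    ring

/-! ### Cancelling the diagonal operators around `T_u`. -/

section Sandwich

variable {A B : Module.End ℂ (bergmanSpace n)} {u : EuclideanSpace ℂ (Fin n) → ℂ}

lemma homogeneousElements_subset_domain_sandwich (hn : 1 ≤ n) (hu : MemLp u 2 (ballMeasure n))
    (hB : IsThinDiagonal B) :
    homogeneousElements n ⊆ (sandwich A (toeplitz u hu) B).domain := by
  rintro _ ⟨k, q, hq, rfl⟩
  obtain ⟨b, -, hB⟩ := hB
  change B hq.toBergman ∈ boundedHolomorphic n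
  rw [apply_toBergman_eq_smul hn hB hq]
  exact Submodule.smul_mem _ _ hq.toBergman_mem_boundedHolomorphic

/-- A Toeplitz operator which is annihilated by thinly vanishing diagonal operators on both sides
has zero symbol. -/
lemma ae_eq_zero_of_sandwich_eq_zero (hn : 1 ≤ n) (hu : MemLp u 2 (ballMeasure n))
    (hA : IsThinDiagonal A) (hB : IsThinDiagonal B)
    (h : ∀ φ : (sandwich A (toeplitz u hu) B).domain, sandwich A (toeplitz u hu) B φ = 0) :
    u =ᵐ[ballMeasure n] 0 := by
  have hdom := homogeneousElements_subset_domain_sandwich (A := A) hn hu hB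
  obtain ⟨a, ha, hA⟩ := hA
  obtain ⟨b, hb, hB⟩ := hB
  refine ae_eq_zero_of_moments_off_thin hn (hu.integrable (by norm_num)) (ha.union hb)
    fun k l q p hk hl hq hp => ?_
  rw [Set.mem_union, not_or] at hk hl
  have h1 : A (toeplitz u hu ⟨B hq.toBergman, hdom ⟨k, q, hq, rfl⟩⟩) = 0 :=
    h ⟨hq.toBergman, hdom ⟨k, q, hq, rfl⟩⟩
  have h2 : (⟨B hq.toBergman, hdom ⟨k, q, hq, rfl⟩⟩ : (toeplitz u hu).domain) =
      b k • ⟨hq.toBergman, hq.toBergman_mem_boundedHolomorphic⟩ :=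
    Subtype.ext (apply_toBergman_eq_smul hn hB hq)
  -- Now `b k • A (T_u q) = 0`. Since `b k ≠ 0` it cancels, and pairing with `p` leaves `a l * ∫ u q
  -- p̄ = 0` with `a l ≠ 0`.
  rw [h2, LinearPMap.map_smul, map_smul] at h1
  have h3 := hA l p hp (toeplitz u hu ⟨hq.toBergman, hq.toBergman_mem_boundedHolomorphic⟩)
  rw [(smul_eq_zero.1 h1).resolve_left hk.2, inner_zero_right, inner_toBergman_toeplitz hu hq hp,
    eq_comm] at h3
  exact (mul_eq_zero.1 h3).resolve_left hl.1

end Sandwich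

lemma isThinDiagonal_toeplitzProd (hn : 1 ≤ n) {N : ℕ}
    {f : Fin N → EuclideanSpace ℂ (Fin n) → ℂ} (hf : ∀ i, MemLp (f i) ∞ (ballMeasure n))
    (hr : ∀ i, IsRadial (f i)) (hf0 : ∀ i, ¬ f i =ᵐ[ballMeasure n] 0) :
    IsThinDiagonal (toeplitzProd f hf) := by
  refine IsThinDiagonal.list_prod fun A hA => ?_
  obtain ⟨i, rfl⟩ := (List.mem_ofFn' _ _).1 hA
  exact isThinDiagonal_toeplitzBounded hn (hf i) (hr i) (hf0 i)

/-- A factor of a product of Toeplitz operators can be singled out. -/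
lemma exists_toeplitzProd_eq_mul (hn : 1 ≤ n) {K : ℕ} {h : Fin K → EuclideanSpace ℂ (Fin n) → ℂ}
    (hh : ∀ i, MemLp (h i) ∞ (ballMeasure n)) (j : Fin K)
    (hr : ∀ i, i ≠ j → IsRadial (h i)) (h0 : ∀ i, i ≠ j → ¬ h i =ᵐ[ballMeasure n] 0) :
    ∃ A B, IsThinDiagonal A ∧ IsThinDiagonal B ∧
      toeplitzProd h hh = A * (toeplitzBounded (h j) (hh j) * B) := by
  obtain ⟨L, hL⟩ : ∃ L, L = List.ofFn fun i => toeplitzBounded (h i) (hh i) := ⟨_, rfl⟩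
  have hlen : L.length = K := by rw [hL, List.length_ofFn]
  have hj : (j : ℕ) < L.length := hlen ▸ j.2
  have hget : ∀ (i : ℕ) (hi : i < L.length), i ≠ j → IsThinDiagonal L[i] := by
    intro i hi hij
    have hne : (⟨i, hlen ▸ hi⟩ : Fin K) ≠ j := fun e => hij (congrArg Fin.val e)
    simp only [hL, List.getElem_ofFn]
    exact isThinDiagonal_toeplitzBounded hn _ (hr _ hne) (h0 _ hne)
  -- The list is split around position `j`. Both pieces avoid `j`, so they contain only radial
  -- nonzero symbols. Either may be empty, giving the identity.
  refine ⟨(L.take j).prod, (L.drop (j + 1)).prod, IsThinDiagonal.list_prod fun A hA => ?_,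
    IsThinDiagonal.list_prod fun A hA => ?_, ?_⟩
  · obtain ⟨i, hi, rfl⟩ := List.getElem_of_mem hA
    rw [List.length_take] at hi
    rw [List.getElem_take]
    exact hget _ _ (by omega)
  · obtain ⟨i, hi, rfl⟩ := List.getElem_of_mem hA
    rw [List.getElem_drop]
    exact hget _ _ (by omega)
  · have h1 : L[(j : ℕ)] = toeplitzBounded (h j) (hh j) := by
      simp only [hL, List.getElem_ofFn]
    rw [toeplitzProd, ← hL, ← h1, ← List.prod_cons, ← List.drop_eq_getElem_cons hj,
      List.prod_take_mul_prod_drop]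

end BergmanBall

/-- In the second part `j` marks the symbol that need not be radial. Its existence also encodes `K ≥
1`. -/
theorem theorem1 (n : ℕ) (hn : 1 ≤ n) :
    -- the zero-product theorem with one square-integrable symbol between radial ones
    (∀ (N M : ℕ)
      (f : Fin N → EuclideanSpace ℂ (Fin n) → ℂ) (g : Fin M → EuclideanSpace ℂ (Fin n) → ℂ)
      (hf : ∀ i, MemLp (f i) ∞ (BergmanBall.ballMeasure n))
      (hg : ∀ i, MemLp (g i) ∞ (BergmanBall.ballMeasure n)),
      (∀ i, BergmanBall.IsRadial (f i)) → (∀ i, BergmanBall.IsRadial (g i)) →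
      (∀ i, ¬ f i =ᵐ[BergmanBall.ballMeasure n] 0) →
      (∀ i, ¬ g i =ᵐ[BergmanBall.ballMeasure n] 0) →
      ∀ (u : EuclideanSpace ℂ (Fin n) → ℂ) (hu : MemLp u 2 (BergmanBall.ballMeasure n)),
        Dense ((BergmanBall.toeplitzProduct f hf u hu g hg).domain :
          Set (BergmanBall.bergmanSpace n)) ∧
        ((∀ φ : (BergmanBall.toeplitzProduct f hf u hu g hg).domain,
            BergmanBall.toeplitzProduct f hf u hu g hg φ = 0) →
          u =ᵐ[BergmanBall.ballMeasure n] 0)) ∧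
    -- the zero-product problem for bounded symbols, all of which except possibly one are radial
    (∀ (K : ℕ) (h : Fin K → EuclideanSpace ℂ (Fin n) → ℂ)
      (hh : ∀ i, MemLp (h i) ∞ (BergmanBall.ballMeasure n)) (j : Fin K),
      (∀ i, i ≠ j → BergmanBall.IsRadial (h i)) →
      BergmanBall.toeplitzProd h hh = 0 →
      ∃ i, h i =ᵐ[BergmanBall.ballMeasure n] 0) := by
  refine ⟨fun N M f g hf hg hfr hgr hf0 hg0 u hu => ⟨?_, fun h => ?_⟩,
    fun K h hh j hr hprod => ?_⟩
  · exact BergmanBall.dense_of_homogeneousElements_subset hn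
      (BergmanBall.homogeneousElements_subset_domain_sandwich hn hu
        (BergmanBall.isThinDiagonal_toeplitzProd hn hg hgr hg0))
  · exact BergmanBall.ae_eq_zero_of_sandwich_eq_zero hn hu
      (BergmanBall.isThinDiagonal_toeplitzProd hn hf hfr hf0)
      (BergmanBall.isThinDiagonal_toeplitzProd hn hg hgr hg0) h
  -- If no symbol vanished, all factors other than the `j`-th would be thinly vanishing diagonal
  -- operators. The `j`-th symbol, being bounded, is in `L²` and plays the role of `u`.
  · by_contra! h0
    obtain ⟨A, B, hA, hB, hAB⟩ :=
      BergmanBall.exists_toeplitzProd_eq_mul hn hh j hr fun i _ => h0 i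
    refine h0 j (BergmanBall.ae_eq_zero_of_sandwich_eq_zero hn ((hh j).mono_exponent le_top)
      hA hB fun φ => ?_)
    have h1 := LinearMap.congr_fun (hAB.symm.trans hprod) (φ : BergmanBall.bergmanSpace n)
    -- On bounded holomorphic functions `toeplitz` and `toeplitzBounded` agree by definition.
    exact h1
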